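/- Let $(X_i,Y_i,Z_i)_{i\ge 1}$ be i.i.d. observations from the linear instrumental variables model $$Y=\beta_0^TX+\epsilon,\qquad X=\gamma^TZ+\xi,$$ with $X\in\mathbb R^p$, $Z\in\mathbb R^d$, $d\ge p$, $\beta_0\in\mathbb R^p$, $\gamma\in\mathbb R^{d\times p}$. Assume that the instruments are relevant, $\operatorname{rank}\mathbb E[ZX^T]=p$, and exogenous, $\mathbb E[Z\epsilon]=0$ and $\mathbb E[Z\xi^T]=0$; that $Z$ is not perfectly collinear (the only $v\in\mathbb R^d$ with $v^TZ=0$ almost surely is $v=0$); that $\epsilon$ is homoskedastic, $\mathbb E[\epsilon^2\mid Z]=\sigma^2:=\mathbb E[\epsilon^2]$; and that $\mathbb E\|Z\|^{2k},\mathbb E\|\xi\|^{2k},\mathbb E|\epsilon|^{2k}<\infty$ for some $k>2$. Put $\Sigma_Z=\mathbb E[ZZ^T]$, and let $\lambda_p(\gamma^T\Sigma_Z\gamma)$ be the smallest eigenvalue of $\gamma^T\Sigma_Z\gamma$. For a sample of size $n$, with data matrices $\mathbf X,\mathbf Y,\mathbf Z$ and $\Pi_{\mathbf Z}=\mathbf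 Z(\mathbf Z^T\mathbf Z)^{-1}\mathbf Z^T$, let $\tilde{\mathbb P}_n$ be the empirical distribution of the projected sample $\big((\Pi_{\mathbf Z}\mathbf X)_i,(\Pi_{\mathbf Z}\mathbf Y)_i\big)_{i=1}^n$ on $\mathbb R^p\times\mathbb R$. Let $\rho_n\ge 0$ be real numbers with $\rho_n\to\rho$. The Wasserstein DRIVE estimator $\hat\beta_n^{\mathrm{DRIVE}}$ is a minimizer over $\beta\in\mathbb R^p$ of $$\sup\big\{\mathbb E_{\mathbb Q}[(Y-X^T\beta)^2] : \mathbb Q \text{ a probability measure on } \mathbb R^p\times\mathbb R,\ W_2(\mathbb Q,\tilde{\mathbb P}_n)^2\le\rho_n\big\},$$ where $W_2$ is the 2-Wasserstein distance for the Euclidean metric; equivalently, it minimizes $\sqrt{\tfrac1n\|\Pi_{\mathbf Z}\mathbf Y-\Pi_{\mathbf Z}\mathbf X\beta\|^2}+\sqrt{\rho_n(\|\beta\|^2+1)}$. The TSLS estimator is $\hat\beta_n^{\mathrm{TSLS}}=(\mathbf X^T\Pi_{\mathbf Z}\mathbf X)^{-1}\mathbf X^T\Pi_{\mathbf Z}\mathbf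 Y$. (The matrices inverted here are invertible with probability tending to one; on the complementary events the values of the estimators are immaterial.) Suppose that one of the following holds: (i) $\rho=0$; (ii) $\rho\le\lambda_p(\gamma^T\Sigma_Z\gamma)$ and $\beta_0=0$; (iii) $\rho\le\lambda_p(\gamma^T\Sigma_Z\gamma)$ and $d=p=1$. Then the Wasserstein DRIVE and the TSLS estimators have the same asymptotic distribution: as $n\to\infty$, both $\sqrt n(\hat\beta_n^{\mathrm{DRIVE}}-\beta_0)$ and $\sqrt n(\hat\beta_n^{\mathrm{TSLS}}-\beta_0)$ converge in distribution to $\mathcal N\big(0,\sigma^2(\gamma^T\Sigma_Z\gamma)^{-1}\big)$. -/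

import Mathlib

open MeasureTheory ProbabilityTheory Filter Topology Matrix
open scoped ENNReal

noncomputable section

namespace WassersteinDRIVE

/-- The space `ℝᵖ × ℝ` of pairs (regressor, outcome), with its Euclidean norm. -/
abbrev Obs (p : ℕ) : Type := WithLp 2 (EuclideanSpace ℝ (Fin p) × ℝ)

/-- Couplings of two measures: measures on the product with these marginals. -/
def couplings {E : Type*} [MeasurableSpace E] (μ ν : Measure E) : Set (Measure (E × E)) :=
  {π | π.map Prod.fst = μ ∧ π.map Prod.snd = ν}

/-- The 2-Wasserstein distance, with values in `[0, ∞]`. -/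
def wasserstein2 {E : Type*} [PseudoEMetricSpace E] [MeasurableSpace E] (μ ν : Measure E) :
    ℝ≥0∞ :=
  (⨅ π ∈ couplings μ ν, ∫⁻ z, edist z.1 z.2 ^ 2 ∂π) ^ (1 / 2 : ℝ)

/-- The empirical distribution of `n` points (used for `n ≥ 1`). -/
def empiricalMeasure {E : Type*} [MeasurableSpace E] {n : ℕ} (w : Fin n → E) : Measure E :=
  (n : ℝ≥0∞)⁻¹ • ∑ i, Measure.dirac (w i)

section Sample

variable {n p d : ℕ}

/-- `Z (Zᵀ Z)⁻¹ Zᵀ`, the projection onto the column space of the instrument matrix. -/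
def projMatrix (Z : Matrix (Fin n) (Fin d) ℝ) : Matrix (Fin n) (Fin n) ℝ :=
  Z * (Zᵀ * Z)⁻¹ * Zᵀ

/-- The projected observations `((Π_Z X)ᵢ, (Π_Z Y)ᵢ)`, `i = 1, …, n`. -/
def projectedSample (X : Matrix (Fin n) (Fin p) ℝ) (Y : Fin n → ℝ)
    (Z : Matrix (Fin n) (Fin d) ℝ) (i : Fin n) : Obs p :=
  WithLp.toLp 2 (WithLp.toLp 2 ((projMatrix Z * X) i), (projMatrix Z *ᵥ Y) i)

/-- The risk `E_Q[(Y - Xᵀ β)²]`. -/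
def risk (Q : Measure (Obs p)) (β : EuclideanSpace ℝ (Fin p)) : ℝ≥0∞ :=
  ∫⁻ w, ENNReal.ofReal ((w.snd - inner ℝ w.fst β) ^ 2) ∂Q

/-- The worst-case risk over all probability measures `Q` with `W₂(Q, μ)² ≤ ρ`. -/
def worstCaseRisk (ρ : ℝ) (μ : Measure (Obs p)) (β : EuclideanSpace ℝ (Fin p)) : ℝ≥0∞ :=
  ⨆ Q ∈ {Q : Measure (Obs p) |
    IsProbabilityMeasure Q ∧ wasserstein2 Q μ ^ 2 ≤ ENNReal.ofReal ρ}, risk Q β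

/-- `β` solves the Wasserstein DRIVE problem with robustness parameter `ρ` for the data
`X, Y, Z`. -/
def IsDRIVE (ρ : ℝ) (X : Matrix (Fin n) (Fin p) ℝ) (Y : Fin n → ℝ)
    (Z : Matrix (Fin n) (Fin d) ℝ) (β : EuclideanSpace ℝ (Fin p)) : Prop :=
  IsMinOn (worstCaseRisk ρ (empiricalMeasure (projectedSample X Y Z))) Set.univ β

/-- The two stage least squares estimator `(Xᵀ Π_Z X)⁻¹ Xᵀ Π_Z Y`. -/
def tsls (X : Matrix (Fin n) (Fin p) ℝ) (Y : Fin n → ℝ)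
    (Z : Matrix (Fin n) (Fin d) ℝ) : EuclideanSpace ℝ (Fin p) :=
  WithLp.toLp 2 ((Xᵀ * projMatrix Z * X)⁻¹ *ᵥ (Xᵀ *ᵥ (projMatrix Z *ᵥ Y)))

end Sample

/-- The matrix whose rows are the first `n` vectors of a sequence. -/
def dataMatrix {m : ℕ} (n : ℕ) (u : ℕ → EuclideanSpace ℝ (Fin m)) : Matrix (Fin n) (Fin m) ℝ :=
  Matrix.of fun i j => u i j

/-- The vector of the first `n` terms of a real sequence. -/
def dataVector (n : ℕ) (y : ℕ → ℝ) : Fin n → ℝ := fun i => y i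

/-- The smallest eigenvalue of a (symmetric) real matrix. -/
def smallestEigenvalue {p : ℕ} (M : Matrix (Fin p) (Fin p) ℝ) : ℝ :=
  sInf {l : ℝ | Module.End.HasEigenvalue (Matrix.toLin' M) l}

variable {Ω : Type*} [MeasurableSpace Ω]

/-- The matrix of cross moments `E[U Vᵀ]`. -/
def crossMoment {a b : ℕ} (P : Measure Ω) (U : Ω → EuclideanSpace ℝ (Fin a))
    (V : Ω → EuclideanSpace ℝ (Fin b)) : Matrix (Fin a) (Fin b) ℝ :=
  Matrix.of fun i j => ∫ ω, U ω i * V ω j ∂P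

/-- I.i.d. observations `(Xᵢ, Yᵢ, Zᵢ)` from the linear instrumental variables model
`Y = β₀ᵀ X + ε`, `X = γᵀ Z + ξ` with relevant and exogenous instruments that are not perfectly
collinear, structural errors `ε` that are homoskedastic given the instruments, and finite moments
of some order `2k > 4`. -/
structure LinearIVModel {p d : ℕ} (P : Measure Ω)
    (β₀ : EuclideanSpace ℝ (Fin p)) (γ : Matrix (Fin d) (Fin p) ℝ)
    (X : ℕ → Ω → EuclideanSpace ℝ (Fin p)) (Y : ℕ → Ω → ℝ)
    (Z : ℕ → Ω → EuclideanSpace ℝ (Fin d))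
    (ε : ℕ → Ω → ℝ) (ξ : ℕ → Ω → EuclideanSpace ℝ (Fin p)) : Prop where
  measurable_X : ∀ i, Measurable (X i)
  measurable_Y : ∀ i, Measurable (Y i)
  measurable_Z : ∀ i, Measurable (Z i)
  indep : iIndepFun (fun i ω => (X i ω, Y i ω, Z i ω)) P
  identDistrib : ∀ i, IdentDistrib (fun ω => (X i ω, Y i ω, Z i ω))
    (fun ω => (X 0 ω, Y 0 ω, Z 0 ω)) P P
  outcome : ∀ i, ∀ᵐ ω ∂P, Y i ω = inner ℝ β₀ (X i ω) + ε i ω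
  first_stage : ∀ i, ∀ᵐ ω ∂P, X i ω = WithLp.toLp 2 (γᵀ *ᵥ (Z i ω).ofLp) + ξ i ω
  relevance : (crossMoment P (Z 0) (X 0)).rank = p
  exogeneity_ε : ∀ j, ∫ ω, Z 0 ω j * ε 0 ω ∂P = 0
  exogeneity_ξ : crossMoment P (Z 0) (ξ 0) = 0
  not_collinear : ∀ v : EuclideanSpace ℝ (Fin d), (∀ᵐ ω ∂P, inner ℝ v (Z 0 ω) = 0) → v = 0
  homoskedastic : P[fun ω => ε 0 ω ^ 2 | MeasurableSpace.comap (Z 0) inferInstance]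
    =ᵐ[P] fun _ => ∫ ω, ε 0 ω ^ 2 ∂P
  moments : ∃ k : ℝ, 2 < k ∧ MemLp (Z 0) (ENNReal.ofReal (2 * k)) P ∧
    MemLp (ξ 0) (ENNReal.ofReal (2 * k)) P ∧ MemLp (ε 0) (ENNReal.ofReal (2 * k)) P

end WassersteinDRIVE

end

/-! Strong duality (`worstCaseRisk_empiricalMeasure`) turns the minimax problem into minimizing
√q(β) + √ρₙ √(‖β‖² + 1). Here q is the mean squared projected residual, which is also the GMM
criterion of the sample moments E[Z(Y - Xᵀβ)] with weight (ZᵀZ/n)⁻¹ (`mean_sq_projected_residual`).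
TSLS is the unpenalized minimizer b, and q is exactly quadratic around b, with Hessian form
converging to A = γᵀ Σ_Z γ (`gmmCriterion_add`, `gmm_hessian_eq`).

By convexity, moving from b to b + u lowers the penalty by at most G‖u‖, with G = √ρₙ ‖b‖/√(‖b‖² +
1). Weighing this against the quadratic growth l‖u‖² of q gives (l - G²)‖u‖ ≤ 2 √q(b) G for the
DRIVE deviation u (`mul_norm_le_of_regularized_le`). Moreover √q(b) is bounded by a constant times
the norm of the mean score, which is of order n^(-1/2). If ρ = 0 or β₀ = 0, then G → 0 and u is
negligible after scaling by √n (`exists_regularized_sub_le`). If d = p = 1, the model is exactly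
identified, so q(b) = 0; since lim G² < A, eventually u = 0 (`eventually_regularized_eq`).

These estimates hold path by path on the almost sure event of the strong law.
`tendstoInMeasure_zero_of_le_mul_norm` converts them to convergence in probability, and Slutsky's
theorem transfers the Gaussian limit of the scores to TSLS and then to DRIVE. -/

namespace WassersteinDRIVE

/-! ### Wasserstein strong duality for squared linear functionals. -/

section Duality

lemma lintegral_empiricalMeasure {E : Type*} [MeasurableSpace E] [MeasurableSingletonClass E]
    {n : ℕ} (hn : 0 < n) (w : Fin n → E) (f : E → ℝ) (hf : ∀ x, 0 ≤ f x) :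
    ∫⁻ x, ENNReal.ofReal (f x) ∂(empiricalMeasure w) =
      ENNReal.ofReal ((∑ i, f (w i)) / n) := by
  unfold empiricalMeasure
  rw [lintegral_smul_measure, lintegral_finsetSum_measure]
  simp only [lintegral_dirac, smul_eq_mul]
  rw [← ENNReal.ofReal_sum_of_nonneg fun i _ => hf _, div_eq_inv_mul,
    ENNReal.ofReal_mul (by positivity), ENNReal.ofReal_inv_of_pos (by exact_mod_cast hn),
    ENNReal.ofReal_natCast]

lemma isProbabilityMeasure_empiricalMeasure {E : Type*} [MeasurableSpace E]
    {n : ℕ} (hn : 0 < n) (w : Fin n → E) : IsProbabilityMeasure (empiricalMeasure w) := by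
  refine ⟨?_⟩
  simp only [empiricalMeasure, Measure.smul_apply, Measure.finsetSum_apply, measure_univ,
    Finset.sum_const, Finset.card_univ, Fintype.card_fin, nsmul_eq_mul, mul_one, smul_eq_mul]
  exact ENNReal.inv_mul_cancel (by exact_mod_cast hn.ne') (ENNReal.natCast_ne_top n)

lemma wasserstein2_sq {E : Type*} [PseudoEMetricSpace E] [MeasurableSpace E] (μ ν : Measure E) :
    wasserstein2 μ ν ^ 2 = ⨅ π ∈ couplings μ ν, ∫⁻ z, edist z.1 z.2 ^ 2 ∂π := by
  rw [wasserstein2, ← ENNReal.rpow_natCast, ← ENNReal.rpow_mul]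
  norm_num

/-- Parameters of the worst-case transport x ↦ x + (s⟪a, x⟫ + c) a. Equality in Minkowski and
Cauchy–Schwarz requires displacements along a, proportional to the residuals ⟪a, wᵢ⟫. -/
lemma exists_transport_attaining {E : Type*} [NormedAddCommGroup E] [InnerProductSpace ℝ E]
    {a : E} (ha : a ≠ 0) {n : ℕ} (hn : 0 < n) (w : Fin n → E)
    {ρ : ℝ} (hρ : 0 ≤ ρ) :
    ∃ s c : ℝ, (∑ i, ((s * inner ℝ a (w i) + c) * ‖a‖) ^ 2) / n = ρ ∧
      (∑ i, (inner ℝ a (w i) + (s * inner ℝ a (w i) + c) * ‖a‖ ^ 2) ^ 2) / n =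
        (√((∑ i, (inner ℝ a (w i) : ℝ) ^ 2) / n) + √ρ * ‖a‖) ^ 2 := by
  have hn' : (n : ℝ) ≠ 0 := by exact_mod_cast hn.ne'
  have ha' : ‖a‖ ≠ 0 := norm_ne_zero_iff.2 ha
  set m := (∑ i, (inner ℝ a (w i) : ℝ) ^ 2) / n with hm
  have hm0 : 0 ≤ m := by positivity
  have hsum : ∑ i, (inner ℝ a (w i) : ℝ) ^ 2 = n * m := by rw [hm]; field_simp
  have hρs : √ρ ^ 2 = ρ := Real.sq_sqrt hρ
  have hms : √m ^ 2 = m := Real.sq_sqrt hm0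
  rcases hm0.eq_or_lt with h0 | h0
  · have hz : ∀ i, (inner ℝ a (w i) : ℝ) = 0 := by
      rw [← h0, mul_zero, Finset.sum_eq_zero_iff_of_nonneg fun i _ => sq_nonneg _] at hsum
      intro i
      exact pow_eq_zero_iff two_ne_zero |>.1 (hsum i (Finset.mem_univ i))
    -- With all residuals zero there is nothing to scale; a common shift of length √ρ along a does
    -- as well.
    refine ⟨0, √ρ / ‖a‖, ?_, ?_⟩
    · simp only [zero_mul, zero_add, Finset.sum_const, Finset.card_univ, Fintype.card_fin,
        nsmul_eq_mul]
      field_simp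
      exact hρs
    · simp only [hz, ← h0, zero_add, mul_zero, Finset.sum_const, Finset.card_univ,
        Fintype.card_fin, nsmul_eq_mul, Real.sqrt_zero]
      field_simp
  · have hr : √m ≠ 0 := (Real.sqrt_pos.2 h0).ne'
    -- Every residual is multiplied by (√m + √ρ ‖a‖)/√m.
    refine ⟨√ρ / (‖a‖ * √m), 0, ?_, ?_⟩
    · have : ∀ i, ((√ρ / (‖a‖ * √m) * inner ℝ a (w i) + 0) * ‖a‖) ^ 2 =
          (ρ / m) * (inner ℝ a (w i)) ^ 2 := fun i => by
        rw [add_zero, mul_pow, mul_pow, div_pow, mul_pow, hρs, hms]; field_simp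
      simp only [this, ← Finset.mul_sum, hsum]
      field_simp
    · have : ∀ i, (inner ℝ a (w i) + (√ρ / (‖a‖ * √m) * inner ℝ a (w i) + 0) * ‖a‖ ^ 2) ^ 2 =
          ((√m + √ρ * ‖a‖) ^ 2 / m) * (inner ℝ a (w i)) ^ 2 := fun i => by
        have e : (√m + √ρ * ‖a‖) ^ 2 / m = (√m + √ρ * ‖a‖) ^ 2 / √m ^ 2 := by rw [hms]
        rw [e]
        field_simp
        ring
      simp only [this, ← Finset.mul_sum, hsum]
      field_simp

/-- The graph of T provides a coupling. -/
lemma wasserstein2_sq_map_le {E : Type*} [NormedAddCommGroup E] [MeasurableSpace E]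
    [BorelSpace E] [SecondCountableTopology E] {μ : Measure E} {T : E → E} (hT : Measurable T) :
    wasserstein2 (μ.map T) μ ^ 2 ≤ ∫⁻ x, edist (T x) x ^ 2 ∂μ := by
  rw [wasserstein2_sq]
  have hm : Measurable fun x => (T x, x) := hT.prodMk measurable_id
  refine (iInf₂_le (μ.map fun x => (T x, x)) ⟨?_, ?_⟩).trans (le_of_eq ?_)
  · rw [lintegral_map (by fun_prop) hm]
  · rw [Measure.map_map measurable_fst hm]; rfl
  · rw [Measure.map_map measurable_snd hm]
    exact Measure.map_id

lemma ofReal_sq_eq_enorm_rpow (x : ℝ) : ENNReal.ofReal (x ^ 2) = ‖x‖ₑ ^ (2 : ℝ) := by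
  rw [Real.enorm_eq_ofReal_abs, ENNReal.rpow_two, ← ENNReal.ofReal_pow (abs_nonneg x), sq_abs]

variable {E : Type*} [NormedAddCommGroup E] [InnerProductSpace ℝ E] [MeasurableSpace E]
  [BorelSpace E] [SecondCountableTopology E]

/-- Minkowski in L²(π) for ⟪a, z₁⟫ = ⟪a, z₂⟫ + ⟪a, z₁ - z₂⟫, with Cauchy–Schwarz on the last term.
-/
lemma sqrt_lintegral_inner_sq_le_of_mem_couplings (a : E) {Q μ : Measure E} {π : Measure (E × E)}
    (hπ : π ∈ couplings Q μ) :
    (∫⁻ x, ENNReal.ofReal (inner ℝ a x ^ 2) ∂Q) ^ (1 / 2 : ℝ) ≤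
      (∫⁻ x, ENNReal.ofReal (inner ℝ a x ^ 2) ∂μ) ^ (1 / 2 : ℝ) +
        ‖a‖ₑ * (∫⁻ z, edist z.1 z.2 ^ 2 ∂π) ^ (1 / 2 : ℝ) := by
  obtain ⟨rfl, rfl⟩ := hπ
  rw [lintegral_map (by fun_prop) measurable_fst, lintegral_map (by fun_prop) measurable_snd]
  simp only [ofReal_sq_eq_enorm_rpow]
  have h1 : AEMeasurable (fun z : E × E => ‖(inner ℝ a z.2 : ℝ)‖ₑ) π := by fun_prop
  have h2 : AEMeasurable (fun z : E × E => ‖a‖ₑ * edist z.1 z.2) π := by fun_prop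
  have key := ENNReal.lintegral_Lp_add_le h1 h2 (p := 2) (by norm_num)
  refine le_trans ?_ (key.trans_eq ?_)
  · refine ENNReal.rpow_le_rpow (lintegral_mono fun z => ?_) (by norm_num)
    refine ENNReal.rpow_le_rpow ?_ (by norm_num)
    have e : (inner ℝ a z.1 : ℝ) = inner ℝ a z.2 + inner ℝ a (z.1 - z.2) := by
      rw [inner_sub_right]; ring
    rw [e]
    refine (enorm_add_le _ _).trans ?_
    simp only [Pi.add_apply]
    gcongr
    rw [edist_eq_enorm_sub, ← ofReal_norm, ← ofReal_norm, ← ofReal_norm,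
      ← ENNReal.ofReal_mul (norm_nonneg _)]
    exact ENNReal.ofReal_le_ofReal (norm_inner_le_norm _ _)
  · congr 1
    simp only [ENNReal.mul_rpow_of_nonneg _ _ (zero_le_two (α := ℝ))]
    rw [lintegral_const_mul _ (by fun_prop), ENNReal.mul_rpow_of_nonneg _ _ (by norm_num),
      ← ENNReal.rpow_mul]
    norm_num

/-- Attainment of the infimum over couplings is avoided: each cost level t > ρ is undercut by some
coupling, and t decreases to ρ. -/
lemma sqrt_lintegral_inner_sq_le (a : E) {Q μ : Measure E} {ρ : ℝ}
    (h : wasserstein2 Q μ ^ 2 ≤ ENNReal.ofReal ρ) :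
    (∫⁻ x, ENNReal.ofReal (inner ℝ a x ^ 2) ∂Q) ^ (1 / 2 : ℝ) ≤
      (∫⁻ x, ENNReal.ofReal (inner ℝ a x ^ 2) ∂μ) ^ (1 / 2 : ℝ) +
        ‖a‖ₑ * (ENNReal.ofReal ρ) ^ (1 / 2 : ℝ) := by
  rw [wasserstein2_sq] at h
  set F : ℝ≥0∞ → ℝ≥0∞ := fun t =>
    (∫⁻ x, ENNReal.ofReal (inner ℝ a x ^ 2) ∂μ) ^ (1 / 2 : ℝ) + ‖a‖ₑ * t ^ (1 / 2 : ℝ)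
  have hF : Continuous F := by
    refine continuous_const.add ?_
    exact (ENNReal.continuous_const_mul enorm_ne_top).comp (ENNReal.continuous_rpow_const)
  have hlim : Tendsto F (𝓝[>] (ENNReal.ofReal ρ)) (𝓝 (F (ENNReal.ofReal ρ))) :=
    (hF.tendsto _).mono_left nhdsWithin_le_nhds
  have : (𝓝[>] (ENNReal.ofReal ρ)).NeBot := nhdsGT_neBot_of_exists_gt ⟨⊤, ENNReal.ofReal_lt_top⟩
  refine ge_of_tendsto hlim ?_
  filter_upwards [self_mem_nhdsWithin] with t ht
  have hlt := lt_of_le_of_lt h ht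
  simp only [iInf_lt_iff] at hlt
  obtain ⟨π, hπ, hlt⟩ := hlt
  refine (sqrt_lintegral_inner_sq_le_of_mem_couplings a hπ).trans ?_
  simp only [F]
  gcongr

lemma iSup_lintegral_inner_sq_eq {a : E} (ha : a ≠ 0) {n : ℕ} (hn : 0 < n) (w : Fin n → E)
    {ρ : ℝ} (hρ : 0 ≤ ρ) :
    ⨆ Q ∈ {Q : Measure E | IsProbabilityMeasure Q ∧
        wasserstein2 Q (empiricalMeasure w) ^ 2 ≤ ENNReal.ofReal ρ},
      ∫⁻ x, ENNReal.ofReal (inner ℝ a x ^ 2) ∂Q =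
    ENNReal.ofReal ((√((∑ i, (inner ℝ a (w i) : ℝ) ^ 2) / n) + √ρ * ‖a‖) ^ 2) := by
  apply le_antisymm
  · refine iSup₂_le fun Q hQ => ?_
    have h := sqrt_lintegral_inner_sq_le a hQ.2
    rw [lintegral_empiricalMeasure hn w (fun x => inner ℝ a x ^ 2) fun x => sq_nonneg _,
      ENNReal.ofReal_rpow_of_nonneg (by positivity) (by norm_num),
      ENNReal.ofReal_rpow_of_nonneg hρ (by norm_num), ← ofReal_norm,
      ← ENNReal.ofReal_mul (norm_nonneg _), ← ENNReal.ofReal_add (by positivity) (by positivity),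
      ← Real.sqrt_eq_rpow, ← Real.sqrt_eq_rpow, mul_comm ‖a‖] at h
    have h2 := pow_le_pow_left₀ (by positivity) h 2
    rw [← ENNReal.rpow_natCast, ← ENNReal.rpow_mul, ← ENNReal.ofReal_pow (by positivity)] at h2
    simpa using h2
  · obtain ⟨s, c, hcost, hrisk⟩ := exists_transport_attaining ha hn w hρ
    set T : E → E := fun x => x + (s * inner ℝ a x + c) • a with hT
    have hTm : Measurable T := by fun_prop
    have := isProbabilityMeasure_empiricalMeasure hn w
    refine le_trans (le_of_eq ?_) (le_iSup₂ ((empiricalMeasure w).map T)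
      ⟨Measure.isProbabilityMeasure_map hTm.aemeasurable,
        (wasserstein2_sq_map_le hTm).trans (le_of_eq ?_)⟩)
    · rw [lintegral_map (by fun_prop) hTm,
        lintegral_empiricalMeasure hn w (fun x => inner ℝ a (T x) ^ 2) fun x => sq_nonneg _,
        ← hrisk]
      simp only [hT, inner_add_right, inner_smul_right, real_inner_self_eq_norm_sq]
    · have : ∀ x, edist (T x) x ^ 2 = ENNReal.ofReal (((s * inner ℝ a x + c) * ‖a‖) ^ 2) := by
        intro x
        rw [edist_eq_enorm_sub, ← ofReal_norm, ← ENNReal.ofReal_pow (norm_nonneg _)]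
        simp only [hT, add_sub_cancel_left, norm_smul, mul_pow, Real.norm_eq_abs, sq_abs]
      simp only [this]
      rw [lintegral_empiricalMeasure hn w _ fun x => sq_nonneg _, hcost]

end Duality

/-- Strong duality: the worst-case risk over a Wasserstein ball around an empirical measure is
the square of a regularized root mean squared residual. -/
lemma worstCaseRisk_empiricalMeasure {n p : ℕ} (hn : 0 < n) (w : Fin n → Obs p) {ρ : ℝ}
    (hρ : 0 ≤ ρ) (β : EuclideanSpace ℝ (Fin p)) :
    worstCaseRisk ρ (empiricalMeasure w) β =
      ENNReal.ofReal ((√((∑ i, ((w i).snd - inner ℝ (w i).fst β) ^ 2) / n) +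
        √ρ * √(‖β‖ ^ 2 + 1)) ^ 2) := by
  -- The residual is the inner product of the observation with (-β, 1), whose norm produces the
  -- penalty.
  set a : Obs p := WithLp.toLp 2 (-β, 1) with ha
  have hin : ∀ x : Obs p, inner ℝ a x = x.snd - inner ℝ x.fst β := fun x => by
    simp [ha, WithLp.prod_inner_apply, real_inner_comm]
    ring
  have hnorm : ‖a‖ = √(‖β‖ ^ 2 + 1) := by
    rw [WithLp.prod_norm_eq_of_L2]; simp [ha]
  have hane : a ≠ 0 := by
    rw [← norm_ne_zero_iff, hnorm]; positivity
  have := iSup_lintegral_inner_sq_eq hane hn w hρ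
  simp only [hin, hnorm] at this
  exact this

/-! ### Slutsky-type tools and the multivariate central limit theorem. -/

section Convergence

variable {Ω Ω' : Type*} [MeasurableSpace Ω] [MeasurableSpace Ω'] {P : Measure Ω}
  [IsProbabilityMeasure P] {μ' : Measure Ω'} [IsProbabilityMeasure μ']

/-- Portmanteau on the closed set {‖x‖ ≥ δ}, which is null for the point mass at 0. -/
lemma tendstoInMeasure_of_tendstoInDistribution_zero {X : ℕ → Ω → ℝ}
    (h : TendstoInDistribution X atTop (fun _ : Ω' => (0 : ℝ)) (fun _ => P) μ') :
    TendstoInMeasure P X atTop 0 := by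
  rw [tendstoInMeasure_iff_norm]
  intro δ hδ
  have hF : IsClosed {x : ℝ | δ ≤ ‖x‖} := isClosed_le continuous_const continuous_norm
  have hlim : Tendsto (fun n => P.map (X n) {x : ℝ | δ ≤ ‖x‖}) atTop (𝓝 0) := by
    refine tendsto_of_le_liminf_of_limsup_le bot_le
      ((ProbabilityMeasure.limsup_measure_closed_le_of_tendsto h.tendsto hF).trans_eq ?_)
    simp [hδ]
  refine hlim.congr fun n => ?_
  rw [Measure.map_apply_of_aemeasurable (h.forall_aemeasurable n) hF.measurableSet]
  simp

/-- The index from which the bound holds depends on ω. The positive part of the excess vanishes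
eventually on almost every path, hence tends to 0 in measure, and δ is split between it and g. -/
lemma tendstoInMeasure_zero_of_eventually_norm_le {F : Type*} [NormedAddCommGroup F]
    {f : ℕ → Ω → F} {g : ℕ → Ω → ℝ} (hf : ∀ n, AEStronglyMeasurable (f n) P)
    (hg : ∀ n, AEStronglyMeasurable (g n) P)
    (hle : ∀ᵐ ω ∂P, ∀ᶠ n in atTop, ‖f n ω‖ ≤ g n ω) (h : TendstoInMeasure P g atTop 0) :
    TendstoInMeasure P f atTop 0 := by
  have hexcess : TendstoInMeasure P (fun n ω => max (‖f n ω‖ - g n ω) 0) atTop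
      (fun _ => (0 : ℝ)) := by
    refine tendstoInMeasure_of_tendsto_ae
      (fun n => (((hf n).norm.sub (hg n)).sup aestronglyMeasurable_const)) ?_
    filter_upwards [hle] with ω hω
    refine tendsto_const_nhds.congr' ?_
    filter_upwards [hω] with n hn
    exact (max_eq_right (sub_nonpos.2 hn)).symm
  rw [tendstoInMeasure_iff_norm] at h hexcess ⊢
  intro δ hδ
  have hsum := (h (δ / 2) (by positivity)).add (hexcess (δ / 2) (by positivity))
  rw [add_zero] at hsum
  refine tendsto_of_tendsto_of_tendsto_of_le_of_le tendsto_const_nhds hsum (fun _ => bot_le)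
    fun n => (measure_mono ?_).trans (measure_union_le _ _)
  intro ω hω
  simp only [Set.mem_ofPred_eq, Set.mem_union, Pi.zero_apply, sub_zero, Real.norm_eq_abs] at hω ⊢
  by_contra! hc
  have h1 := (le_abs_self _).trans_lt hc.1
  have h2 := (le_max_left _ _).trans_lt ((le_abs_self _).trans_lt hc.2)
  linarith

/-- A sequence that is pathwise negligible relative to a sequence converging in distribution
converges to zero in probability. -/
lemma tendstoInMeasure_zero_of_le_mul_norm {E F : Type*} [NormedAddCommGroup E]
    [MeasurableSpace E] [BorelSpace E] [SecondCountableTopology E] [NormedAddCommGroup F]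
    {D : ℕ → Ω → F} {s : ℕ → Ω → E} {W : Ω' → E}
    (hs : TendstoInDistribution s atTop W (fun _ => P) μ')
    (hD : ∀ n, AEStronglyMeasurable (D n) P)
    (h : ∀ᵐ ω ∂P, ∃ a : ℕ → ℝ, Tendsto a atTop (𝓝 0) ∧
      ∀ᶠ n in atTop, ‖D n ω‖ ≤ a n * ‖s n ω‖) :
    TendstoInMeasure P D atTop 0 := by
  have hsm := hs.forall_aemeasurable
  -- The rate a depends on ω with no measurability; the ratio q is a measurable substitute that it
  -- dominates.
  set q : ℕ → Ω → ℝ := fun n ω => ‖D n ω‖ / ‖s n ω‖ with hq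
  have hqm : ∀ n, AEMeasurable (q n) P := fun n =>
    (hD n).norm.aemeasurable.div (hsm n).norm
  have hq0 : TendstoInMeasure P q atTop (fun _ => (0 : ℝ)) := by
    refine tendstoInMeasure_of_tendsto_ae (fun n => (hqm n).aestronglyMeasurable) ?_
    filter_upwards [h] with ω ⟨a, ha, hle⟩
    refine squeeze_zero' (Eventually.of_forall fun n => by positivity) (g := fun n => |a n|) ?_
      (by simpa using ha.abs)
    filter_upwards [hle] with n hn
    refine div_le_of_le_mul₀ (norm_nonneg _) (abs_nonneg _) (hn.trans ?_)
    gcongr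
    exact le_abs_self _
  have hprod : TendstoInDistribution (fun n ω => ‖s n ω‖ * q n ω) atTop
      (fun ω => ‖W ω‖ * 0) (fun _ => P) μ' :=
    hs.continuous_comp_prodMk_of_tendstoInMeasure_const
      (g := fun x : E × ℝ => ‖x.1‖ * x.2) (by fun_prop) hq0 hqm
  simp only [mul_zero] at hprod
  refine tendstoInMeasure_zero_of_eventually_norm_le hD
    (fun n => (hprod.forall_aemeasurable n).aestronglyMeasurable) ?_
    (tendstoInMeasure_of_tendstoInDistribution_zero hprod)
  filter_upwards [h] with ω ⟨a, ha, hle⟩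
  filter_upwards [hle] with n hn
  -- Where s vanishes q is 0 by convention, and the assumed bound forces D to vanish too.
  rcases eq_or_ne ‖s n ω‖ 0 with h0 | h0
  · simpa [h0] using hn
  · simp only [hq]
    rw [mul_div_cancel₀ _ h0]

/-- The multivariate central limit theorem for centered vectors. -/
theorem tendstoInDistribution_inv_sqrt_smul_sum {ι : Type*} [Fintype ι] [DecidableEq ι]
    {W : ℕ → Ω → EuclideanSpace ℝ ι} (hindep : iIndepFun W P)
    (hident : ∀ i, IdentDistrib (W i) (W 0) P P) (hL2 : MemLp (W 0) 2 P)
    (hmean : ∀ t, ∫ ω, inner ℝ t (W 0 ω) ∂P = 0) {S : Matrix ι ι ℝ} (hS : S.PosSemidef)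
    (hcov : ∀ t : EuclideanSpace ℝ ι,
      ∫ ω, (inner ℝ t (W 0 ω) : ℝ) ^ 2 ∂P = t.ofLp ⬝ᵥ S *ᵥ t.ofLp) :
    TendstoInDistribution (fun (n : ℕ) ω => (√(n : ℝ))⁻¹ • ∑ k ∈ Finset.range n, W k ω) atTop
      id (fun _ => P) (multivariateGaussian 0 S) := by
  have hm : ∀ i, AEMeasurable (W i) P := fun i => (hident i).aemeasurable_fst
  have hsm : ∀ n : ℕ, AEMeasurable (fun ω => (√(n : ℝ))⁻¹ • ∑ k ∈ Finset.range n, W k ω) P :=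
    fun n => (Finset.aemeasurable_fun_sum _ fun i _ => hm i).const_smul (√(n : ℝ))⁻¹
  refine ⟨hsm, aemeasurable_id, ?_⟩
  refine ProbabilityMeasure.tendsto_iff_tendsto_charFun.2 fun t => ?_
  have hproj : Measurable fun x : EuclideanSpace ℝ ι => (inner ℝ t x : ℝ) := by fun_prop
  have hL2' : MemLp (fun ω => (inner ℝ t (W 0 ω) : ℝ)) 2 P := hL2.const_inner t
  have hvar : Var[fun ω => (inner ℝ t (W 0 ω) : ℝ); P] = t.ofLp ⬝ᵥ S *ᵥ t.ofLp := by
    rw [variance_of_integral_eq_zero hL2'.aestronglyMeasurable.aemeasurable (hmean t)]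
    exact hcov t
  have clt := tendstoInDistribution_inv_sqrt_mul_sum_sub (P := P)
    (X := fun i ω => (inner ℝ t (W i ω) : ℝ)) (Y := id)
    (P' := gaussianReal 0 (Var[fun ω => (inner ℝ t (W 0 ω) : ℝ); P]).toNNReal)
    HasLaw.id hL2' (hindep.comp (fun _ x => (inner ℝ t x : ℝ)) fun _ => hproj)
    (fun i => (hident i).comp hproj)
  -- Cramér–Wold: the characteristic function of the vector at t is that of its projection on t at
  -- 1.
  have hcf := ProbabilityMeasure.tendsto_iff_tendsto_charFun.1 clt.tendsto 1
  simp only [ProbabilityMeasure.coe_mk, Measure.map_id, hmean, mul_zero, sub_zero] at hcf ⊢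
  rw [charFun_multivariateGaussian hS]
  rw [charFun_gaussianReal, hvar, Real.coe_toNNReal _ (by
    simpa using hS.dotProduct_mulVec_nonneg t.ofLp)] at hcf
  convert! hcf using 2 with n
  · rw [charFun_apply, charFun_apply, integral_map (hsm n) (by fun_prop),
      integral_map (clt.forall_aemeasurable n |>.congr (by simp [hmean])) (by fun_prop)]
    simp [inner_smul_left, sum_inner, real_inner_comm]
  · simp
end Convergence

/-! ### Algebra of the quadratic moment criterion. -/

section GMM

variable {p d : ℕ}

/-- The criterion of the generalized method of moments with weight `S⁻¹` for the moment
equation `c = C β`. -/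
noncomputable def gmmCriterion (S : Matrix (Fin d) (Fin d) ℝ) (C : Matrix (Fin d) (Fin p) ℝ)
    (c : Fin d → ℝ) (β : Fin p → ℝ) : ℝ :=
  (c - C *ᵥ β) ⬝ᵥ S⁻¹ *ᵥ (c - C *ᵥ β)

/-- The linear map sending the moment vector `c` to the minimizer of the criterion. -/
noncomputable def gmmMatrix (S : Matrix (Fin d) (Fin d) ℝ) (C : Matrix (Fin d) (Fin p) ℝ) :
    Matrix (Fin p) (Fin d) ℝ :=
  (Cᵀ * S⁻¹ * C)⁻¹ * Cᵀ * S⁻¹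

variable {S : Matrix (Fin d) (Fin d) ℝ} {C : Matrix (Fin d) (Fin p) ℝ}

lemma gmmMatrix_mul (hA : IsUnit (Cᵀ * S⁻¹ * C).det) : gmmMatrix S C * C = 1 := by
  rw [gmmMatrix, Matrix.mul_assoc, Matrix.mul_assoc, ← Matrix.mul_assoc Cᵀ, nonsing_inv_mul _ hA]

lemma gmmMatrix_mulVec_sub (hA : IsUnit (Cᵀ * S⁻¹ * C).det) (c : Fin d → ℝ) (β : Fin p → ℝ) :
    gmmMatrix S C *ᵥ c - β = gmmMatrix S C *ᵥ (c - C *ᵥ β) := by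
  rw [mulVec_sub, mulVec_mulVec, gmmMatrix_mul hA, one_mulVec]

lemma gmm_normal_equations (hA : IsUnit (Cᵀ * S⁻¹ * C).det) (c : Fin d → ℝ) :
    Cᵀ *ᵥ (S⁻¹ *ᵥ (c - C *ᵥ (gmmMatrix S C *ᵥ c))) = 0 := by
  have h : (Cᵀ * S⁻¹ * C) * gmmMatrix S C = Cᵀ * S⁻¹ := by
    rw [gmmMatrix, Matrix.mul_assoc _⁻¹, ← Matrix.mul_assoc, mul_nonsing_inv _ hA, Matrix.one_mul]
  rw [mulVec_sub, mulVec_sub, mulVec_mulVec, mulVec_mulVec, mulVec_mulVec, mulVec_mulVec,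
    h, sub_self]

/-- Pythagoras: the normal equations kill the cross terms, so the expansion around the minimizer is
exact. -/
lemma gmmCriterion_add (hS : Sᵀ = S) (hA : IsUnit (Cᵀ * S⁻¹ * C).det) (c : Fin d → ℝ)
    (u : Fin p → ℝ) :
    gmmCriterion S C c (gmmMatrix S C *ᵥ c + u) =
      gmmCriterion S C c (gmmMatrix S C *ᵥ c) + u ⬝ᵥ (Cᵀ * S⁻¹ * C) *ᵥ u := by
  have hSi : (S⁻¹)ᵀ = S⁻¹ := by rw [transpose_nonsing_inv, hS]
  set e := c - C *ᵥ (gmmMatrix S C *ᵥ c) with he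
  have hn : Cᵀ *ᵥ (S⁻¹ *ᵥ e) = 0 := gmm_normal_equations hA c
  have h1 : (C *ᵥ u) ⬝ᵥ S⁻¹ *ᵥ e = 0 := by
    rw [dotProduct_comm, dotProduct_mulVec, ← mulVec_transpose, hn, zero_dotProduct]
  have h2 : e ⬝ᵥ S⁻¹ *ᵥ (C *ᵥ u) = 0 := by
    rw [dotProduct_mulVec, ← mulVec_transpose, hSi, dotProduct_comm, h1]
  have h3 : (C *ᵥ u) ⬝ᵥ S⁻¹ *ᵥ (C *ᵥ u) = u ⬝ᵥ (Cᵀ * S⁻¹ * C) *ᵥ u := by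
    rw [← mulVec_mulVec, ← mulVec_mulVec, dotProduct_mulVec u, vecMul_transpose]
  have e1 : c - C *ᵥ (gmmMatrix S C *ᵥ c + u) = e - C *ᵥ u := by
    rw [mulVec_add, he]; abel
  rw [gmmCriterion, e1, gmmCriterion, ← he, mulVec_sub, dotProduct_sub,
    sub_dotProduct _ _ (S⁻¹ *ᵥ e), sub_dotProduct _ _ (S⁻¹ *ᵥ (C *ᵥ u)), h1, h2, h3]
  ring

/-- Exact identification: Cᵀ is invertible, so the normal equations annihilate the weighted residual
itself. -/
lemma gmmCriterion_eq_zero_of_square {S C : Matrix (Fin d) (Fin d) ℝ}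
    (hA : IsUnit (Cᵀ * S⁻¹ * C).det) (c : Fin d → ℝ) :
    gmmCriterion S C c (gmmMatrix S C *ᵥ c) = 0 := by
  have hC : IsUnit (Cᵀ).det := by
    rw [det_mul, det_mul] at hA
    exact isUnit_of_mul_isUnit_left (isUnit_of_mul_isUnit_left hA)
  have h : (Cᵀ)⁻¹ *ᵥ (Cᵀ *ᵥ (S⁻¹ *ᵥ (c - C *ᵥ (gmmMatrix S C *ᵥ c)))) = 0 := by
    rw [gmm_normal_equations hA c, mulVec_zero]
  rw [mulVec_mulVec, nonsing_inv_mul _ hC, one_mulVec] at h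
  rw [gmmCriterion, h, dotProduct_zero]

end GMM

/-! ### DRIVE and TSLS in terms of sample moments. -/

section FiniteSample

variable {n p d : ℕ} {X : Matrix (Fin n) (Fin p) ℝ} {Y : Fin n → ℝ}
  {Z : Matrix (Fin n) (Fin d) ℝ}

lemma transpose_projMatrix (Z : Matrix (Fin n) (Fin d) ℝ) : (projMatrix Z)ᵀ = projMatrix Z := by
  simp [projMatrix, transpose_nonsing_inv, Matrix.mul_assoc]

lemma projMatrix_mul_self (hZ : IsUnit (Zᵀ * Z).det) :
    projMatrix Z * projMatrix Z = projMatrix Z := by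
  have : projMatrix Z * projMatrix Z = Z * (Zᵀ * Z)⁻¹ * ((Zᵀ * Z) * (Zᵀ * Z)⁻¹) * Zᵀ := by
    simp only [projMatrix, Matrix.mul_assoc]
  rw [this, mul_nonsing_inv _ hZ, Matrix.mul_one, projMatrix]

lemma inv_smul_of_ne_zero {m : ℕ} {k : ℝ} (hk : k ≠ 0) {M : Matrix (Fin m) (Fin m) ℝ}
    (hM : IsUnit M.det) : (k • M)⁻¹ = k⁻¹ • M⁻¹ := by
  have := invertibleOfNonzero hk
  rw [inv_smul _ k hM, invOf_eq_inv]

/-- As Π_Z is a symmetric idempotent, ‖Π_Z r‖² = rᵀ Π_Z r depends on r only through Zᵀ r. -/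
lemma mean_sq_projected_residual (hn : 0 < n) (hZ : IsUnit (Zᵀ * Z).det)
    (β : EuclideanSpace ℝ (Fin p)) :
    (∑ i, ((projectedSample X Y Z i).snd - inner ℝ (projectedSample X Y Z i).fst β) ^ 2) / n =
      gmmCriterion ((n : ℝ)⁻¹ • (Zᵀ * Z)) ((n : ℝ)⁻¹ • (Zᵀ * X)) ((n : ℝ)⁻¹ • (Zᵀ *ᵥ Y)) β := by
  have hn' : (n : ℝ) ≠ 0 := by exact_mod_cast hn.ne'
  set r := Y - X *ᵥ β.ofLp with hr
  have e1 : ∀ i, (projectedSample X Y Z i).snd - inner ℝ (projectedSample X Y Z i).fst β =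
      (projMatrix Z *ᵥ r) i := fun i => by
    rw [hr, mulVec_sub, mulVec_mulVec]
    simp [projectedSample, EuclideanSpace.inner_eq_star_dotProduct, mulVec, dotProduct_comm]
  have e2 : ((n : ℝ)⁻¹ • (Zᵀ *ᵥ Y)) - ((n : ℝ)⁻¹ • (Zᵀ * X)) *ᵥ β.ofLp =
      (n : ℝ)⁻¹ • (Zᵀ *ᵥ r) := by
    rw [hr, mulVec_sub, smul_sub, smul_mulVec, mulVec_mulVec]
  have e3 : ∑ i, (projMatrix Z *ᵥ r) i ^ 2 = (Zᵀ *ᵥ r) ⬝ᵥ (Zᵀ * Z)⁻¹ *ᵥ (Zᵀ *ᵥ r) := by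
    have : ∑ i, (projMatrix Z *ᵥ r) i ^ 2 = (projMatrix Z *ᵥ r) ⬝ᵥ (projMatrix Z *ᵥ r) := by
      simp [dotProduct, sq]
    rw [this, dotProduct_mulVec, ← mulVec_transpose, transpose_projMatrix, mulVec_mulVec,
      projMatrix_mul_self hZ, dotProduct_comm, projMatrix, ← mulVec_mulVec, ← mulVec_mulVec,
      dotProduct_mulVec, ← mulVec_transpose]
  simp only [e1, e3]
  rw [gmmCriterion, e2, inv_smul_of_ne_zero (inv_ne_zero hn') hZ]
  simp only [smul_mulVec, mulVec_smul, smul_dotProduct, dotProduct_smul, smul_eq_mul]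
  field_simp

lemma tsls_eq_gmmMatrix_mulVec (hn : 0 < n) (hZ : IsUnit (Zᵀ * Z).det)
    (hA : IsUnit (((n : ℝ)⁻¹ • (Zᵀ * X))ᵀ * ((n : ℝ)⁻¹ • (Zᵀ * Z))⁻¹ *
      ((n : ℝ)⁻¹ • (Zᵀ * X))).det) :
    (tsls X Y Z).ofLp = gmmMatrix ((n : ℝ)⁻¹ • (Zᵀ * Z)) ((n : ℝ)⁻¹ • (Zᵀ * X)) *ᵥ
      ((n : ℝ)⁻¹ • (Zᵀ *ᵥ Y)) := by
  have hn' : (n : ℝ) ≠ 0 := by exact_mod_cast hn.ne'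
  have e : ((n : ℝ)⁻¹ • (Zᵀ * X))ᵀ * ((n : ℝ)⁻¹ • (Zᵀ * Z))⁻¹ * ((n : ℝ)⁻¹ • (Zᵀ * X)) =
      (n : ℝ)⁻¹ • (Xᵀ * projMatrix Z * X) := by
    rw [inv_smul_of_ne_zero (inv_ne_zero hn') hZ]
    simp only [transpose_smul, transpose_mul, transpose_transpose, Matrix.smul_mul,
      Matrix.mul_smul, projMatrix, Matrix.mul_assoc, smul_smul]
    congr 1
    field_simp
  have hM : (Xᵀ * projMatrix Z * X) =
      (n : ℝ) • (((n : ℝ)⁻¹ • (Zᵀ * X))ᵀ * ((n : ℝ)⁻¹ • (Zᵀ * Z))⁻¹ *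
      ((n : ℝ)⁻¹ • (Zᵀ * X))) := by
    rw [e, smul_smul, mul_inv_cancel₀ hn', one_smul]
  rw [tsls, hM, inv_smul_of_ne_zero hn' hA, gmmMatrix,
    inv_smul_of_ne_zero (inv_ne_zero hn') hZ]
  generalize (((n : ℝ)⁻¹ • (Zᵀ * X))ᵀ * ((n : ℝ)⁻¹⁻¹ • (Zᵀ * Z)⁻¹) *
    ((n : ℝ)⁻¹ • (Zᵀ * X)))⁻¹ = B
  simp only [smul_mulVec, mulVec_smul, mulVec_mulVec, transpose_smul, transpose_mul,
    transpose_transpose, Matrix.smul_mul, Matrix.mul_smul, smul_smul, projMatrix,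
    Matrix.mul_assoc]
  congr 1
  field_simp

lemma IsDRIVE.sqrt_add_le {ρ : ℝ} (hρ : 0 ≤ ρ) (hn : 0 < n) (hZ : IsUnit (Zᵀ * Z).det)
    {β : EuclideanSpace ℝ (Fin p)} (h : IsDRIVE ρ X Y Z β) (β' : EuclideanSpace ℝ (Fin p)) :
    √(gmmCriterion ((n : ℝ)⁻¹ • (Zᵀ * Z)) ((n : ℝ)⁻¹ • (Zᵀ * X)) ((n : ℝ)⁻¹ • (Zᵀ *ᵥ Y)) β) +
        √ρ * √(‖β‖ ^ 2 + 1) ≤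
      √(gmmCriterion ((n : ℝ)⁻¹ • (Zᵀ * Z)) ((n : ℝ)⁻¹ • (Zᵀ * X)) ((n : ℝ)⁻¹ • (Zᵀ *ᵥ Y)) β') +
        √ρ * √(‖β'‖ ^ 2 + 1) := by
  have h' := h (Set.mem_univ β')
  simp only [Set.mem_ofPred_eq, worstCaseRisk_empiricalMeasure hn _ hρ,
    mean_sq_projected_residual hn hZ] at h'
  rw [ENNReal.ofReal_le_ofReal_iff (sq_nonneg _)] at h'
  exact (sq_le_sq₀ (by positivity) (by positivity)).1 h'

lemma gmmCriterion_nonneg (hn : 0 < n) (hZ : IsUnit (Zᵀ * Z).det) (β : Fin p → ℝ) :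
    0 ≤ gmmCriterion ((n : ℝ)⁻¹ • (Zᵀ * Z)) ((n : ℝ)⁻¹ • (Zᵀ * X)) ((n : ℝ)⁻¹ • (Zᵀ *ᵥ Y)) β := by
  rw [← mean_sq_projected_residual hn hZ (WithLp.toLp 2 β)]
  positivity

end FiniteSample

/-- Tangent bound for the convex function √(‖·‖² + 1) at b, whose gradient has norm ‖b‖/√(‖b‖² + 1).
-/
lemma sqrt_norm_sq_add_one_sub_le {E : Type*} [NormedAddCommGroup E] [InnerProductSpace ℝ E]
    (b u : E) :
    √(‖b‖ ^ 2 + 1) - ‖b‖ / √(‖b‖ ^ 2 + 1) * ‖u‖ ≤ √(‖b + u‖ ^ 2 + 1) := by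
  set s := √(‖b‖ ^ 2 + 1) with hs
  have hs0 : 0 < s := by positivity
  have hs2 : s ^ 2 = ‖b‖ ^ 2 + 1 := Real.sq_sqrt (by positivity)
  have e : s - ‖b‖ / s * ‖u‖ = (‖b‖ ^ 2 + 1 - ‖b‖ * ‖u‖) / s := by
    rw [← hs2]; field_simp
  rw [e, div_le_iff₀ hs0, hs, ← Real.sqrt_mul (by positivity)]
  refine Real.le_sqrt_of_sq_le ?_
  have h1 : ‖b + u‖ ^ 2 = ‖b‖ ^ 2 + 2 * inner ℝ b u + ‖u‖ ^ 2 := norm_add_sq_real b u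
  have h2 : |inner ℝ b u| ≤ ‖b‖ * ‖u‖ := abs_real_inner_le_norm b u
  have h3 := neg_le_of_abs_le h2
  rw [h1]
  nlinarith [mul_nonneg (add_nonneg (sq_nonneg ‖b‖) zero_le_one)
    (by linarith : 0 ≤ inner ℝ b u + ‖b‖ * ‖u‖), sq_nonneg (‖u‖), norm_nonneg b, norm_nonneg u,
    sq_nonneg (‖b‖ * ‖u‖)]

/-- Comparison of a minimizer of a ridge-like regularized criterion with the minimizer `b` of the
unregularized one. -/
lemma mul_norm_le_of_regularized_le {E : Type*} [NormedAddCommGroup E] [InnerProductSpace ℝ E]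
    {b u : E} {q₀ q l ρ : ℝ} (hq₀ : 0 ≤ q₀) (hq : q₀ + l * ‖u‖ ^ 2 ≤ q)
    (h : √q + √ρ * √(‖b + u‖ ^ 2 + 1) ≤ √q₀ + √ρ * √(‖b‖ ^ 2 + 1)) :
    (l - (√ρ * (‖b‖ / √(‖b‖ ^ 2 + 1))) ^ 2) * ‖u‖ ≤
      2 * √q₀ * (√ρ * (‖b‖ / √(‖b‖ ^ 2 + 1))) := by
  set G := √ρ * (‖b‖ / √(‖b‖ ^ 2 + 1)) with hG
  have hG0 : 0 ≤ G := by positivity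
  rcases (norm_nonneg u).eq_or_lt with h0 | h0
  · rw [← h0, mul_zero]; positivity
  have h1 := mul_le_mul_of_nonneg_left (sqrt_norm_sq_add_one_sub_le b u) (Real.sqrt_nonneg ρ)
  have h2 : √q ≤ √q₀ + G * ‖u‖ := by rw [hG]; linarith
  -- After insertion of q₀ + l‖u‖² ≤ q, the terms q₀ cancel and one factor ‖u‖ > 0 can be divided
  -- out.
  have h3 : q ≤ (√q₀ + G * ‖u‖) ^ 2 := (Real.sqrt_le_left (by positivity)).1 h2
  have h4 : √q₀ ^ 2 = q₀ := Real.sq_sqrt hq₀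
  refine le_of_mul_le_mul_right ?_ h0
  nlinarith

/-! ### Deterministic asymptotics along one sample path. -/

section Pathwise

open scoped Matrix.Norms.L2Operator

variable {p d : ℕ}

lemma abs_dotProduct_mulVec_le {m n : ℕ} (M : Matrix (Fin m) (Fin n) ℝ)
    (x : EuclideanSpace ℝ (Fin m)) (y : EuclideanSpace ℝ (Fin n)) :
    |x.ofLp ⬝ᵥ M *ᵥ y.ofLp| ≤ ‖M‖ * ‖x‖ * ‖y‖ := by
  have h1 : x.ofLp ⬝ᵥ M *ᵥ y.ofLp = inner ℝ (WithLp.toLp 2 (M *ᵥ y.ofLp)) x := by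
    simp [EuclideanSpace.inner_eq_star_dotProduct]
  rw [h1]
  refine (abs_real_inner_le_norm _ _).trans ?_
  have h2 : ‖WithLp.toLp 2 (M *ᵥ y.ofLp)‖ ≤ ‖M‖ * ‖y‖ := l2_opNorm_mulVec M y
  have := mul_le_mul_of_nonneg_right h2 (norm_nonneg x)
  linarith

lemma exists_pos_mul_norm_sq_le {A : Matrix (Fin p) (Fin p) ℝ} (hA : A.PosDef) :
    ∃ l > 0, ∀ u : EuclideanSpace ℝ (Fin p), l * ‖u‖ ^ 2 ≤ u.ofLp ⬝ᵥ A *ᵥ u.ofLp := by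
  have hc : Continuous fun u : EuclideanSpace ℝ (Fin p) => u.ofLp ⬝ᵥ A *ᵥ u.ofLp := by
    fun_prop
  rcases (Metric.sphere (0 : EuclideanSpace ℝ (Fin p)) 1).eq_empty_or_nonempty with he | hne
  -- The unit sphere is empty only in dimension zero, where any constant works.
  · refine ⟨1, one_pos, fun u => ?_⟩
    have hu : u = 0 := by
      by_contra hu
      have : (‖u‖⁻¹ • u) ∈ Metric.sphere (0 : EuclideanSpace ℝ (Fin p)) 1 := by
        simp [norm_smul, hu]
      simp [he] at this
    simp [hu]
  · obtain ⟨v, hv, hmin⟩ := (isCompact_sphere (0 : EuclideanSpace ℝ (Fin p)) 1).exists_isMinOn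
      hne hc.continuousOn
    have hv0 : v.ofLp ≠ 0 := by
      intro h
      have : v = 0 := by ext i; simp [h]
      simp [this] at hv
    refine ⟨v.ofLp ⬝ᵥ A *ᵥ v.ofLp, by simpa using hA.dotProduct_mulVec_pos hv0, fun u => ?_⟩
    rcases eq_or_ne u 0 with rfl | hu
    · simp
    have hn : ‖u‖ ≠ 0 := norm_ne_zero_iff.2 hu
    have hm : (‖u‖⁻¹ • u) ∈ Metric.sphere (0 : EuclideanSpace ℝ (Fin p)) 1 := by
      simp [norm_smul, hu]
    have h := hmin hm
    simp only [Set.mem_ofPred_eq, WithLp.ofLp_smul, mulVec_smul, smul_dotProduct,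
      dotProduct_smul, smul_eq_mul] at h
    calc _ ≤ (‖u‖⁻¹ * (‖u‖⁻¹ * (u.ofLp ⬝ᵥ A *ᵥ u.ofLp))) * ‖u‖ ^ 2 := by gcongr
      _ = _ := by field_simp

/-- Uniformity in u comes from the operator norm: the two forms differ by at most ‖A n - B‖ ‖u‖². -/
lemma eventually_mul_norm_sq_le {A : ℕ → Matrix (Fin p) (Fin p) ℝ}
    {B : Matrix (Fin p) (Fin p) ℝ} (hA : Tendsto A atTop (𝓝 B)) {l₀ l : ℝ}
    (hB : ∀ u : EuclideanSpace ℝ (Fin p), l₀ * ‖u‖ ^ 2 ≤ u.ofLp ⬝ᵥ B *ᵥ u.ofLp) (hl : l < l₀) :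
    ∀ᶠ n in atTop, ∀ u : EuclideanSpace ℝ (Fin p),
      l * ‖u‖ ^ 2 ≤ u.ofLp ⬝ᵥ A n *ᵥ u.ofLp := by
  have h0 : Tendsto (fun n => ‖A n - B‖) atTop (𝓝 0) := by
    simpa using (hA.sub_const B).norm
  filter_upwards [h0.eventually_lt_const (sub_pos.2 hl)] with n hn u
  have h1 := neg_le_of_abs_le (abs_dotProduct_mulVec_le (A n - B) u u)
  rw [sub_mulVec, dotProduct_sub] at h1
  nlinarith [hB u, mul_le_mul_of_nonneg_right hn.le (sq_nonneg ‖u‖)]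

lemma tendsto_matrix_inv {m : ℕ} {A : ℕ → Matrix (Fin m) (Fin m) ℝ}
    {B : Matrix (Fin m) (Fin m) ℝ} (hA : Tendsto A atTop (𝓝 B)) (hB : B.det ≠ 0) :
    Tendsto (fun n => (A n)⁻¹) atTop (𝓝 B⁻¹) := by
  refine (continuousAt_matrix_inv B ?_).tendsto.comp hA
  rw [Ring.inverse_eq_inv']
  exact continuousAt_inv₀ hB

lemma tendsto_matrix_mul {k m n : ℕ} {A : ℕ → Matrix (Fin k) (Fin m) ℝ}
    {B : ℕ → Matrix (Fin m) (Fin n) ℝ} {A' : Matrix (Fin k) (Fin m) ℝ}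
    {B' : Matrix (Fin m) (Fin n) ℝ} (hA : Tendsto A atTop (𝓝 A')) (hB : Tendsto B atTop (𝓝 B')) :
    Tendsto (fun i => A i * B i) atTop (𝓝 (A' * B')) :=
  (Continuous.matrix_mul continuous_fst continuous_snd).tendsto (A', B') |>.comp
    (hA.prodMk_nhds hB)

lemma tendsto_matrix_det {m : ℕ} {A : ℕ → Matrix (Fin m) (Fin m) ℝ}
    {B : Matrix (Fin m) (Fin m) ℝ} (hA : Tendsto A atTop (𝓝 B)) :
    Tendsto (fun n => (A n).det) atTop (𝓝 B.det) :=
  (continuous_id.matrix_det.tendsto B).comp hA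

variable {S : ℕ → Matrix (Fin d) (Fin d) ℝ} {C : ℕ → Matrix (Fin d) (Fin p) ℝ}
  {c : ℕ → Fin d → ℝ} {T : Matrix (Fin d) (Fin d) ℝ} {Γ : Matrix (Fin d) (Fin p) ℝ}

lemma tendsto_gmm_hessian (hS : Tendsto S atTop (𝓝 T)) (hT : T.det ≠ 0)
    (hC : Tendsto C atTop (𝓝 Γ)) :
    Tendsto (fun n => (C n)ᵀ * (S n)⁻¹ * C n) atTop (𝓝 (Γᵀ * T⁻¹ * Γ)) :=
  tendsto_matrix_mul (tendsto_matrix_mul ((continuous_id.matrix_transpose.tendsto Γ).comp hC)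
    (tendsto_matrix_inv hS hT)) hC

lemma eventually_isUnit_det {m : ℕ} {A : ℕ → Matrix (Fin m) (Fin m) ℝ}
    {B : Matrix (Fin m) (Fin m) ℝ} (hA : Tendsto A atTop (𝓝 B)) (hB : B.det ≠ 0) :
    ∀ᶠ n in atTop, IsUnit (A n).det := by
  filter_upwards [(tendsto_matrix_det hA).eventually_ne hB] with n hn using hn.isUnit

lemma tendsto_gmmMatrix (hS : Tendsto S atTop (𝓝 T)) (hT : T.det ≠ 0)
    (hC : Tendsto C atTop (𝓝 Γ)) (hA : (Γᵀ * T⁻¹ * Γ).det ≠ 0) :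
    Tendsto (fun n => gmmMatrix (S n) (C n)) atTop (𝓝 (gmmMatrix T Γ)) :=
  tendsto_matrix_mul (tendsto_matrix_mul (tendsto_matrix_inv (tendsto_gmm_hessian hS hT hC) hA)
    ((continuous_id.matrix_transpose.tendsto Γ).comp hC)) (tendsto_matrix_inv hS hT)

/-- The estimation error is asymptotically linear in the moment residual. -/
lemma exists_gmm_linearization (hS : Tendsto S atTop (𝓝 T)) (hT : T.det ≠ 0)
    (hC : Tendsto C atTop (𝓝 Γ)) (hA : (Γᵀ * T⁻¹ * Γ).det ≠ 0) (β₀ : Fin p → ℝ) :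
    ∃ a : ℕ → ℝ, Tendsto a atTop (𝓝 0) ∧ ∀ᶠ n in atTop,
      ‖WithLp.toLp 2 (gmmMatrix (S n) (C n) *ᵥ c n - β₀ -
          gmmMatrix T Γ *ᵥ (c n - C n *ᵥ β₀))‖ ≤
        a n * ‖WithLp.toLp 2 (c n - C n *ᵥ β₀)‖ := by
  refine ⟨fun n => ‖gmmMatrix (S n) (C n) - gmmMatrix T Γ‖, ?_, ?_⟩
  · simpa using ((tendsto_gmmMatrix hS hT hC hA).sub_const (gmmMatrix T Γ)).norm
  · filter_upwards [eventually_isUnit_det (tendsto_gmm_hessian hS hT hC) hA] with n hn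
    rw [gmmMatrix_mulVec_sub hn, ← sub_mulVec]
    exact l2_opNorm_mulVec _ (WithLp.toLp 2 (c n - C n *ᵥ β₀))

lemma tendsto_gmmEstimator (hS : Tendsto S atTop (𝓝 T)) (hT : T.det ≠ 0)
    (hC : Tendsto C atTop (𝓝 Γ)) (hA : (Γᵀ * T⁻¹ * Γ).det ≠ 0)
    {β₀ : EuclideanSpace ℝ (Fin p)}
    (hg : Tendsto (fun n => c n - C n *ᵥ β₀.ofLp) atTop (𝓝 0)) :
    Tendsto (fun n => WithLp.toLp 2 (gmmMatrix (S n) (C n) *ᵥ c n)) atTop (𝓝 β₀) := by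
  have h1 : Tendsto (fun n => gmmMatrix (S n) (C n) *ᵥ (c n - C n *ᵥ β₀.ofLp) + β₀.ofLp) atTop
      (𝓝 (gmmMatrix T Γ *ᵥ 0 + β₀.ofLp)) :=
    ((Continuous.matrix_mulVec continuous_fst continuous_snd).tendsto (gmmMatrix T Γ, 0) |>.comp
      ((tendsto_gmmMatrix hS hT hC hA).prodMk_nhds hg)).add_const _
  rw [mulVec_zero, zero_add] at h1
  have h2 := ((PiLp.continuous_toLp 2 (fun _ : Fin p => ℝ)).tendsto β₀.ofLp).comp h1
  refine h2.congr' ?_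
  filter_upwards [eventually_isUnit_det (tendsto_gmm_hessian hS hT hC) hA] with n hn
  simp [← gmmMatrix_mulVec_sub hn]

variable {ρ : ℕ → ℝ} {ρlim : ℝ} {β₀ : EuclideanSpace ℝ (Fin p)}
  {β : ℕ → EuclideanSpace ℝ (Fin p)}

/-- `mul_norm_le_of_regularized_le` at the unpenalized minimizer b n; the gap l < l₀ absorbs the
error of the sample Hessian. -/
lemma eventually_mul_norm_regularized_sub_le (hS : Tendsto S atTop (𝓝 T)) (hT : T.det ≠ 0)
    (hsymm : ∀ n, (S n)ᵀ = S n) (hC : Tendsto C atTop (𝓝 Γ)) (hA : (Γᵀ * T⁻¹ * Γ).det ≠ 0)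
    (hnonneg : ∀ᶠ n in atTop, ∀ β', 0 ≤ gmmCriterion (S n) (C n) (c n) β')
    (hmin : ∀ᶠ n in atTop, ∀ β' : EuclideanSpace ℝ (Fin p),
      √(gmmCriterion (S n) (C n) (c n) (β n)) + √(ρ n) * √(‖β n‖ ^ 2 + 1) ≤
        √(gmmCriterion (S n) (C n) (c n) β') + √(ρ n) * √(‖β'‖ ^ 2 + 1))
    {l₀ l : ℝ} (hl : l < l₀) (hl₀ : ∀ u : EuclideanSpace ℝ (Fin p),
      l₀ * ‖u‖ ^ 2 ≤ u.ofLp ⬝ᵥ (Γᵀ * T⁻¹ * Γ) *ᵥ u.ofLp)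
    {b : ℕ → EuclideanSpace ℝ (Fin p)}
    (hb : b = fun n => WithLp.toLp 2 (gmmMatrix (S n) (C n) *ᵥ c n)) :
    ∀ᶠ n in atTop,
      (l - (√(ρ n) * (‖b n‖ / √(‖b n‖ ^ 2 + 1))) ^ 2) * ‖β n - b n‖ ≤
        2 * √(gmmCriterion (S n) (C n) (c n) (b n)) *
          (√(ρ n) * (‖b n‖ / √(‖b n‖ ^ 2 + 1))) := by
  have hH := tendsto_gmm_hessian hS hT hC
  filter_upwards [eventually_mul_norm_sq_le hH hl₀ hl, eventually_isUnit_det hH hA, hmin,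
    hnonneg] with n h1 h2 h3 h4
  refine mul_norm_le_of_regularized_le (q := gmmCriterion (S n) (C n) (c n) (β n)) (h4 _) ?_ ?_
  · have := gmmCriterion_add (hsymm n) h2 (c n) (β n - b n).ofLp
    have e : gmmMatrix (S n) (C n) *ᵥ c n + (β n - b n).ofLp = (β n).ofLp := by
      simp [hb]
    rw [e] at this
    rw [this]
    have e' : (b n).ofLp = gmmMatrix (S n) (C n) *ᵥ c n := by rw [hb]
    rw [e']
    have := h1 (β n - b n)
    linarith
  · rw [add_sub_cancel]
    exact h3 (b n)

lemma tendsto_sqrt_mul_norm_div {b : ℕ → EuclideanSpace ℝ (Fin p)}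
    (hρ : Tendsto ρ atTop (𝓝 ρlim)) (hb : Tendsto b atTop (𝓝 β₀)) :
    Tendsto (fun n => √(ρ n) * (‖b n‖ / √(‖b n‖ ^ 2 + 1))) atTop
      (𝓝 (√ρlim * (‖β₀‖ / √(‖β₀‖ ^ 2 + 1)))) := by
  refine hρ.sqrt.mul (hb.norm.div ?_ (by positivity))
  exact ((hb.norm.pow 2).add_const 1).sqrt

/-- If the penalty has a vanishing slope, the regularized minimizer differs from the unregularized
one by a quantity that is negligible relative to the moment residual. -/
lemma exists_regularized_sub_le (hS : Tendsto S atTop (𝓝 T)) (hT : T.det ≠ 0)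
    (hsymm : ∀ n, (S n)ᵀ = S n) (hC : Tendsto C atTop (𝓝 Γ)) (hA : (Γᵀ * T⁻¹ * Γ).PosDef)
    (hnonneg : ∀ᶠ n in atTop, ∀ β', 0 ≤ gmmCriterion (S n) (C n) (c n) β')
    (hg : Tendsto (fun n => c n - C n *ᵥ β₀.ofLp) atTop (𝓝 0))
    (hρ : Tendsto ρ atTop (𝓝 ρlim)) (hcase : ρlim = 0 ∨ β₀ = 0)
    (hmin : ∀ᶠ n in atTop, ∀ β' : EuclideanSpace ℝ (Fin p),
      √(gmmCriterion (S n) (C n) (c n) (β n)) + √(ρ n) * √(‖β n‖ ^ 2 + 1) ≤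
        √(gmmCriterion (S n) (C n) (c n) β') + √(ρ n) * √(‖β'‖ ^ 2 + 1)) :
    ∃ a : ℕ → ℝ, Tendsto a atTop (𝓝 0) ∧ ∀ᶠ n in atTop,
      ‖β n - WithLp.toLp 2 (gmmMatrix (S n) (C n) *ᵥ c n)‖ ≤
        a n * ‖WithLp.toLp 2 (c n - C n *ᵥ β₀.ofLp)‖ := by
  obtain ⟨l₀, hl₀, hlow⟩ := exists_pos_mul_norm_sq_le hA
  have hdet := hA.det_pos.ne'
  set b : ℕ → EuclideanSpace ℝ (Fin p) :=
    fun n => WithLp.toLp 2 (gmmMatrix (S n) (C n) *ᵥ c n) with hb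
  set G : ℕ → ℝ := fun n => √(ρ n) * (‖b n‖ / √(‖b n‖ ^ 2 + 1)) with hG
  have hGlim : Tendsto G atTop (𝓝 0) := by
    have := tendsto_sqrt_mul_norm_div hρ (tendsto_gmmEstimator hS hT hC hdet hg)
    -- The limiting slope √ρ ‖β₀‖/√(‖β₀‖² + 1) contains both factors that may vanish.
    rcases hcase with rfl | rfl <;> simpa using this
  have hH := tendsto_gmm_hessian hS hT hC
  have hden : Tendsto (fun n => l₀ / 2 - G n ^ 2) atTop (𝓝 (l₀ / 2)) := by
    simpa using (hGlim.pow 2).const_sub (l₀ / 2)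
  refine ⟨fun n => 2 * √‖(S n)⁻¹‖ * G n / (l₀ / 2 - G n ^ 2), ?_, ?_⟩
  · have := ((((tendsto_matrix_inv hS hT).norm.sqrt).const_mul 2).mul hGlim).div hden
      (by positivity)
    simpa only [mul_zero, zero_div] using! this
  · filter_upwards [eventually_mul_norm_regularized_sub_le hS hT hsymm hC hdet hnonneg hmin
      (half_lt_self hl₀) hlow hb, hden.eventually_const_lt (half_pos hl₀),
      eventually_mul_norm_sq_le hH hlow hl₀, eventually_isUnit_det hH hdet]
      with n h1 h2 h3 h4
    have hG0 : 0 ≤ G n := by positivity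
    -- The criterion at its minimizer b n is at most its value at β₀, a quadratic form in the moment
    -- residual.
    have hcrit : √(gmmCriterion (S n) (C n) (c n) (b n)) ≤
        √‖(S n)⁻¹‖ * ‖WithLp.toLp 2 (c n - C n *ᵥ β₀.ofLp)‖ := by
      rw [Real.sqrt_le_left (by positivity), mul_pow, Real.sq_sqrt (norm_nonneg _)]
      have e := gmmCriterion_add (hsymm n) h4 (c n) (β₀ - b n).ofLp
      have e' : gmmMatrix (S n) (C n) *ᵥ c n + (β₀ - b n).ofLp = β₀.ofLp := by simp [hb]
      rw [e'] at e
      have hpos := h3 (β₀ - b n)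
      have hle := (le_abs_self _).trans (abs_dotProduct_mulVec_le (S n)⁻¹
        (WithLp.toLp 2 (c n - C n *ᵥ β₀.ofLp)) (WithLp.toLp 2 (c n - C n *ᵥ β₀.ofLp)))
      have hβ₀ : gmmCriterion (S n) (C n) (c n) β₀.ofLp =
        (c n - C n *ᵥ β₀.ofLp) ⬝ᵥ (S n)⁻¹ *ᵥ (c n - C n *ᵥ β₀.ofLp) := rfl
      rw [hβ₀] at e
      have hbn : (b n).ofLp = gmmMatrix (S n) (C n) *ᵥ c n := rfl
      rw [hbn]
      simp only [zero_mul] at hpos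
      nlinarith
    rw [div_mul_eq_mul_div, le_div_iff₀ h2, mul_comm]
    refine h1.trans ?_
    have := mul_le_mul_of_nonneg_right hcrit hG0
    simp only [hG] at this ⊢
    nlinarith

/-- In the exactly identified case a regularization below the identification threshold is
eventually inactive. -/
lemma eventually_regularized_eq {S C : ℕ → Matrix (Fin p) (Fin p) ℝ}
    {c : ℕ → Fin p → ℝ} {T Γ : Matrix (Fin p) (Fin p) ℝ}
    (hS : Tendsto S atTop (𝓝 T)) (hT : T.det ≠ 0)
    (hsymm : ∀ n, (S n)ᵀ = S n) (hC : Tendsto C atTop (𝓝 Γ)) (hA : (Γᵀ * T⁻¹ * Γ).det ≠ 0)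
    (hnonneg : ∀ᶠ n in atTop, ∀ β', 0 ≤ gmmCriterion (S n) (C n) (c n) β')
    (hg : Tendsto (fun n => c n - C n *ᵥ β₀.ofLp) atTop (𝓝 0))
    (hρ : Tendsto ρ atTop (𝓝 ρlim)) {l₀ : ℝ} (hl₀ : 0 < l₀) (hρlim : 0 ≤ ρlim) (hρl : ρlim ≤ l₀)
    (hlow : ∀ u : EuclideanSpace ℝ (Fin p),
      l₀ * ‖u‖ ^ 2 ≤ u.ofLp ⬝ᵥ (Γᵀ * T⁻¹ * Γ) *ᵥ u.ofLp)
    (hmin : ∀ᶠ n in atTop, ∀ β' : EuclideanSpace ℝ (Fin p),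
      √(gmmCriterion (S n) (C n) (c n) (β n)) + √(ρ n) * √(‖β n‖ ^ 2 + 1) ≤
        √(gmmCriterion (S n) (C n) (c n) β') + √(ρ n) * √(‖β'‖ ^ 2 + 1)) :
    ∀ᶠ n in atTop, β n = WithLp.toLp 2 (gmmMatrix (S n) (C n) *ᵥ c n) := by
  set b : ℕ → EuclideanSpace ℝ (Fin p) :=
    fun n => WithLp.toLp 2 (gmmMatrix (S n) (C n) *ᵥ c n) with hb
  have hGlim := (tendsto_sqrt_mul_norm_div hρ (tendsto_gmmEstimator hS hT hC hA hg)).pow 2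
  -- Strict even for ρ = l₀, because ‖β₀‖²/(‖β₀‖² + 1) < 1.
  have hlt : (√ρlim * (‖β₀‖ / √(‖β₀‖ ^ 2 + 1))) ^ 2 < l₀ := by
    rw [mul_pow, div_pow, Real.sq_sqrt hρlim, Real.sq_sqrt (by positivity), mul_div_assoc',
      div_lt_iff₀ (by positivity)]
    nlinarith [sq_nonneg ‖β₀‖]
  obtain ⟨l, hl1, hl2⟩ := exists_between hlt
  filter_upwards [eventually_mul_norm_regularized_sub_le hS hT hsymm hC hA hnonneg hmin
    hl2 hlow hb, hGlim.eventually_lt_const hl1,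
    eventually_isUnit_det (tendsto_gmm_hessian hS hT hC) hA] with n h1 h2 h3
  have hz : gmmCriterion (S n) (C n) (c n) (b n).ofLp = 0 := gmmCriterion_eq_zero_of_square h3 _
  rw [hz, Real.sqrt_zero, mul_zero, zero_mul] at h1
  have h4 : ‖β n - b n‖ ≤ 0 := by
    by_contra hc
    have := mul_pos (sub_pos.2 h2) (not_le.1 hc)
    exact absurd h1 (not_le.2 this)
  exact sub_eq_zero.1 (norm_le_zero_iff.1 h4)

end Pathwise

/-! ### Cross-moment matrices. -/

section Moments

variable {Ω : Type*} [MeasurableSpace Ω] {P : Measure Ω}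

lemma memLp_ofLp_apply {m : ℕ} {q : ℝ≥0∞} {U : Ω → EuclideanSpace ℝ (Fin m)} (hU : MemLp U q P)
    (i : Fin m) : MemLp (fun ω => U ω i) q P := by
  have h := hU.const_inner (𝕜 := ℝ) (EuclideanSpace.single i (1 : ℝ))
  simpa [EuclideanSpace.inner_single_left] using h

lemma dotProduct_crossMoment_mulVec {a b : ℕ} {U : Ω → EuclideanSpace ℝ (Fin a)}
    {V : Ω → EuclideanSpace ℝ (Fin b)} (hU : MemLp U 2 P) (hV : MemLp V 2 P)
    (x : EuclideanSpace ℝ (Fin a)) (y : EuclideanSpace ℝ (Fin b)) :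
    x.ofLp ⬝ᵥ crossMoment P U V *ᵥ y.ofLp = ∫ ω, inner ℝ x (U ω) * inner ℝ y (V ω) ∂P := by
  have hInt : ∀ i j, Integrable (fun ω => U ω i * V ω j) P := fun i j =>
    (memLp_ofLp_apply hU i).integrable_mul (memLp_ofLp_apply hV j)
  have e : ∀ ω, (inner ℝ x (U ω) * inner ℝ y (V ω) : ℝ) =
      ∑ i, ∑ j, x i * y j * (U ω i * V ω j) := fun ω => by
    simp only [PiLp.inner_apply, RCLike.inner_apply, conj_trivial, Finset.sum_mul_sum]
    refine Finset.sum_congr rfl fun i _ => Finset.sum_congr rfl fun j _ => by ring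
  simp only [e]
  rw [integral_finsetSum _ fun i _ => integrable_finsetSum _ fun j _ => (hInt i j).const_mul _]
  simp only [dotProduct, mulVec, Finset.mul_sum]
  refine Finset.sum_congr rfl fun i _ => ?_
  rw [integral_finsetSum _ fun j _ => (hInt i j).const_mul _]
  refine Finset.sum_congr rfl fun j _ => ?_
  rw [integral_const_mul, crossMoment, of_apply]
  ring

lemma transpose_crossMoment_self {a : ℕ} (U : Ω → EuclideanSpace ℝ (Fin a)) :
    (crossMoment P U U)ᵀ = crossMoment P U U := by
  ext i j
  simp [crossMoment, mul_comm]

lemma posDef_crossMoment_self {a : ℕ} {U : Ω → EuclideanSpace ℝ (Fin a)} (hU : MemLp U 2 P)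
    (h : ∀ v : EuclideanSpace ℝ (Fin a), (∀ᵐ ω ∂P, inner ℝ v (U ω) = 0) → v = 0) :
    (crossMoment P U U).PosDef := by
  rw [posDef_iff_dotProduct_mulVec]
  refine ⟨by rw [IsHermitian, conjTranspose_eq_transpose_of_trivial, transpose_crossMoment_self],
    fun x hx => ?_⟩
  have e := dotProduct_crossMoment_mulVec hU hU (WithLp.toLp 2 x) (WithLp.toLp 2 x)
  have hL2 : MemLp (fun ω => (inner ℝ (WithLp.toLp 2 x) (U ω) : ℝ)) 2 P := hU.const_inner _
  simp only [star_trivial]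
  simp only at e
  rw [e]
  refine lt_of_le_of_ne (integral_nonneg fun ω => mul_self_nonneg _) fun h0 => hx ?_
  have hz := (integral_eq_zero_iff_of_nonneg (fun ω => mul_self_nonneg _)
    (hL2.integrable_mul hL2)).1 h0.symm
  have := h (WithLp.toLp 2 x) (hz.mono fun ω hω => mul_self_eq_zero.1 hω)
  simpa using congrArg WithLp.ofLp this

end Moments

/-! ### Population identities and laws of large numbers in the model. -/

namespace LinearIVModel

variable {p d : ℕ} {β₀ : EuclideanSpace ℝ (Fin p)}

/-- The moment contribution `(Y - β₀ᵀ X) Z` of one observation. -/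
noncomputable def score (β₀ : EuclideanSpace ℝ (Fin p))
    (w : EuclideanSpace ℝ (Fin p) × ℝ × EuclideanSpace ℝ (Fin d)) : EuclideanSpace ℝ (Fin d) :=
  (w.2.1 - inner ℝ β₀ w.1) • w.2.2

lemma measurable_score : Measurable (score β₀ (d := d)) := by
  unfold score
  fun_prop

/-- Makes ε Z square integrable when ε and Z have fourth moments. -/
lemma holderTriple_four_four_two : ENNReal.HolderTriple 4 4 2 where
  inv_add_inv_eq_inv := by
    rw [← ENNReal.toReal_eq_toReal_iff' (by simp) (by simp), ENNReal.toReal_add (by simp) (by simp)]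
    norm_num

variable {Ω : Type*} {X : ℕ → Ω → EuclideanSpace ℝ (Fin p)} {Y : ℕ → Ω → ℝ}
  {Z : ℕ → Ω → EuclideanSpace ℝ (Fin d)}

/-- The moment residual at β₀ is a sample mean of scores, so the strong law and the central limit
theorem apply to it. -/
lemma mean_moment_residual_eq (n : ℕ) (ω : Ω) :
    (n : ℝ)⁻¹ • ((dataMatrix n (Z · ω))ᵀ *ᵥ dataVector n (Y · ω)) -
      ((n : ℝ)⁻¹ • ((dataMatrix n (Z · ω))ᵀ * dataMatrix n (X · ω))) *ᵥ β₀.ofLp =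
    (n : ℝ)⁻¹ • (∑ i ∈ Finset.range n, score β₀ (X i ω, Y i ω, Z i ω)).ofLp := by
  rw [smul_mulVec, ← smul_sub, ← mulVec_mulVec, ← mulVec_sub, Finset.sum_range]
  congr 1
  ext j
  simp only [mulVec, dotProduct, dataMatrix, dataVector, score, transpose_apply, of_apply,
    Pi.sub_apply, PiLp.inner_apply, RCLike.inner_apply, conj_trivial, WithLp.ofLp_sum,
    Finset.sum_apply, WithLp.ofLp_smul, Pi.smul_apply, smul_eq_mul]
  exact Finset.sum_congr rfl fun i _ => mul_comm _ _

variable [MeasurableSpace Ω] {P : Measure Ω} {γ : Matrix (Fin d) (Fin p) ℝ} {ε : ℕ → Ω → ℝ}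
  {ξ : ℕ → Ω → EuclideanSpace ℝ (Fin p)}

/-- The score is built from the observed triple, where the i.i.d. assumption lives; this form gives
access to the assumptions on ε. -/
lemma score_ae_eq (h : LinearIVModel P β₀ γ X Y Z ε ξ) (i : ℕ) :
    (fun ω => score β₀ (X i ω, Y i ω, Z i ω)) =ᵐ[P] fun ω => ε i ω • Z i ω := by
  filter_upwards [h.outcome i] with ω hω
  simp [score, hω]

lemma identDistrib_comp (h : LinearIVModel P β₀ γ X Y Z ε ξ) {F : Type*} [MeasurableSpace F]
    {φ : EuclideanSpace ℝ (Fin p) × ℝ × EuclideanSpace ℝ (Fin d) → F} (hφ : Measurable φ)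
    (i : ℕ) : IdentDistrib (fun ω => φ (X i ω, Y i ω, Z i ω))
      (fun ω => φ (X 0 ω, Y 0 ω, Z 0 ω)) P P :=
  (h.identDistrib i).comp hφ

lemma iIndepFun_comp (h : LinearIVModel P β₀ γ X Y Z ε ξ) {F : Type*} [MeasurableSpace F]
    {φ : EuclideanSpace ℝ (Fin p) × ℝ × EuclideanSpace ℝ (Fin d) → F} (hφ : Measurable φ) :
    iIndepFun (fun i ω => φ (X i ω, Y i ω, Z i ω)) P :=
  h.indep.comp (fun _ => φ) fun _ => hφ

lemma strong_law (h : LinearIVModel P β₀ γ X Y Z ε ξ)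
    {φ : EuclideanSpace ℝ (Fin p) × ℝ × EuclideanSpace ℝ (Fin d) → ℝ} (hφ : Measurable φ)
    (hInt : Integrable (fun ω => φ (X 0 ω, Y 0 ω, Z 0 ω)) P) :
    ∀ᵐ ω ∂P, Tendsto (fun n : ℕ => (n : ℝ)⁻¹ * ∑ i : Fin n, φ (X i ω, Y i ω, Z i ω)) atTop
      (𝓝 (∫ ω, φ (X 0 ω, Y 0 ω, Z 0 ω) ∂P)) := by
  have := strong_law_ae_real (fun i ω => φ (X i ω, Y i ω, Z i ω)) hInt
    (fun i j hij => (h.iIndepFun_comp hφ).indepFun hij) (h.identDistrib_comp hφ)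
  filter_upwards [this] with ω hω
  refine hω.congr fun n => ?_
  rw [div_eq_inv_mul, Finset.sum_range]

variable [IsProbabilityMeasure P]

lemma memLp_four (h : LinearIVModel P β₀ γ X Y Z ε ξ) :
    MemLp (Z 0) 4 P ∧ MemLp (ξ 0) 4 P ∧ MemLp (ε 0) 4 P := by
  obtain ⟨k, hk, h1, h2, h3⟩ := h.moments
  have hle : (4 : ℝ≥0∞) ≤ ENNReal.ofReal (2 * k) := by
    rw [show (4 : ℝ≥0∞) = ENNReal.ofReal 4 by simp]
    exact ENNReal.ofReal_le_ofReal (by linarith)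
  exact ⟨h1.mono_exponent hle, h2.mono_exponent hle, h3.mono_exponent hle⟩

lemma memLp_two_Z (h : LinearIVModel P β₀ γ X Y Z ε ξ) : MemLp (Z 0) 2 P :=
  h.memLp_four.1.mono_exponent (by norm_num)

lemma memLp_two_X (h : LinearIVModel P β₀ γ X Y Z ε ξ) : MemLp (X 0) 2 P := by
  have h1 : MemLp (fun ω => (toLpLin 2 2 γᵀ).toContinuousLinearMap (Z 0 ω)) 2 P :=
    h.memLp_two_Z.continuousLinearMap_comp _
  have h2 : MemLp (ξ 0) 2 P := h.memLp_four.2.1.mono_exponent (by norm_num)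
  refine (memLp_congr_ae ?_).2 (h1.add h2)
  filter_upwards [h.first_stage 0] with ω hω
  rw [hω]
  rfl

lemma posDef_crossMoment (h : LinearIVModel P β₀ γ X Y Z ε ξ) :
    (crossMoment P (Z 0) (Z 0)).PosDef :=
  posDef_crossMoment_self h.memLp_two_Z h.not_collinear

/-- Exogeneity E[Zξᵀ] = 0 removes the first-stage noise. -/
lemma crossMoment_Z_X (h : LinearIVModel P β₀ γ X Y Z ε ξ) :
    crossMoment P (Z 0) (X 0) = crossMoment P (Z 0) (Z 0) * γ := by
  have hZ := h.memLp_two_Z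
  have h2 : MemLp (ξ 0) 2 P := h.memLp_four.2.1.mono_exponent (by norm_num)
  ext i j
  have hξ : ∫ ω, Z 0 ω i * ξ 0 ω j ∂P = 0 := congrFun (congrFun h.exogeneity_ξ i) j
  have hInt : ∀ c, Integrable (fun ω => Z 0 ω i * Z 0 ω c) P := fun c =>
    (memLp_ofLp_apply hZ i).integrable_mul (memLp_ofLp_apply hZ c)
  have e : (fun ω => Z 0 ω i * X 0 ω j) =ᵐ[P]
      fun ω => (∑ c, (Z 0 ω i * Z 0 ω c) * γ c j) + Z 0 ω i * ξ 0 ω j := by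
    filter_upwards [h.first_stage 0] with ω hω
    rw [hω]
    simp only [WithLp.ofLp_add, Pi.add_apply, mulVec, dotProduct, transpose_apply, mul_add,
      Finset.mul_sum]
    congr 1
    exact Finset.sum_congr rfl fun c _ => by ring
  have hIntξ : Integrable (fun ω => Z 0 ω i * ξ 0 ω j) P :=
    (memLp_ofLp_apply hZ i).integrable_mul (memLp_ofLp_apply h2 j)
  have hsum : Integrable (fun ω => ∑ c, (Z 0 ω i * Z 0 ω c) * γ c j) P :=
    integrable_finsetSum _ fun c _ => (hInt c).mul_const _
  rw [crossMoment, of_apply, integral_congr_ae e, integral_add hsum hIntξ, hξ, add_zero,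
    integral_finsetSum _ fun c _ => (hInt c).mul_const _, mul_apply]
  simp only [integral_mul_const, crossMoment, of_apply]

/-- Σ_Z is invertible, so relevance gives γ the full column rank of Σ_Z γ. -/
lemma injective_mulVec_γ (h : LinearIVModel P β₀ γ X Y Z ε ξ) :
    Function.Injective γ.mulVec := by
  have hr := h.relevance
  rw [h.crossMoment_Z_X, rank_mul_eq_right_of_isUnit_det _ _
    h.posDef_crossMoment.det_pos.ne'.isUnit] at hr
  rw [mulVec_injective_iff, linearIndependent_iff_card_eq_finrank_span, Set.finrank,
    ← rank_eq_finrank_span_cols, hr, Fintype.card_fin]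

lemma posDef_first_stage (h : LinearIVModel P β₀ γ X Y Z ε ξ) :
    (γᵀ * crossMoment P (Z 0) (Z 0) * γ).PosDef := by
  have := h.posDef_crossMoment.conjTranspose_mul_mul_same h.injective_mulVec_γ
  rwa [conjTranspose_eq_transpose_of_trivial] at this

lemma gmm_hessian_eq (h : LinearIVModel P β₀ γ X Y Z ε ξ) :
    (crossMoment P (Z 0) (X 0))ᵀ * (crossMoment P (Z 0) (Z 0))⁻¹ * crossMoment P (Z 0) (X 0) =
      γᵀ * crossMoment P (Z 0) (Z 0) * γ := by
  rw [h.crossMoment_Z_X, transpose_mul, transpose_crossMoment_self, Matrix.mul_assoc γᵀ,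
    mul_nonsing_inv _ h.posDef_crossMoment.det_pos.ne'.isUnit, Matrix.mul_one,
    ← Matrix.mul_assoc]

lemma gmmMatrix_eq (h : LinearIVModel P β₀ γ X Y Z ε ξ) :
    gmmMatrix (crossMoment P (Z 0) (Z 0)) (crossMoment P (Z 0) (X 0)) =
      (γᵀ * crossMoment P (Z 0) (Z 0) * γ)⁻¹ * γᵀ := by
  rw [gmmMatrix, h.gmm_hessian_eq, h.crossMoment_Z_X, transpose_mul,
    transpose_crossMoment_self, Matrix.mul_assoc _⁻¹, Matrix.mul_assoc γᵀ _ (_⁻¹),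
    mul_nonsing_inv _ h.posDef_crossMoment.det_pos.ne'.isUnit, Matrix.mul_one]

lemma memLp_score (h : LinearIVModel P β₀ γ X Y Z ε ξ) :
    MemLp (fun ω => score β₀ (X 0 ω, Y 0 ω, Z 0 ω)) 2 P := by
  rw [memLp_congr_ae (h.score_ae_eq 0)]
  have := holderTriple_four_four_two
  exact h.memLp_four.1.smul h.memLp_four.2.2

lemma integral_inner_score (h : LinearIVModel P β₀ γ X Y Z ε ξ)
    (t : EuclideanSpace ℝ (Fin d)) :
    ∫ ω, inner ℝ t (score β₀ (X 0 ω, Y 0 ω, Z 0 ω)) ∂P = 0 := by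
  have hε : MemLp (ε 0) 2 P := h.memLp_four.2.2.mono_exponent (by norm_num)
  have e : (fun ω => (inner ℝ t (score β₀ (X 0 ω, Y 0 ω, Z 0 ω)) : ℝ)) =ᵐ[P]
      fun ω => ∑ j, t j * (Z 0 ω j * ε 0 ω) := by
    filter_upwards [h.score_ae_eq 0] with ω hω
    rw [hω]
    simp only [PiLp.inner_apply, RCLike.inner_apply, conj_trivial, WithLp.ofLp_smul,
      Pi.smul_apply, smul_eq_mul]
    exact Finset.sum_congr rfl fun j _ => by ring
  have hInt : ∀ j, Integrable (fun ω => Z 0 ω j * ε 0 ω) P := fun j =>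
    (memLp_ofLp_apply h.memLp_two_Z j).integrable_mul hε
  rw [integral_congr_ae e, integral_finsetSum _ fun j _ => (hInt j).const_mul _]
  simp [integral_const_mul, h.exogeneity_ε]

/-- Conditioning on Z pulls out ⟪t, Z⟫² and leaves E[ε² | Z], which homoskedasticity makes constant.
-/
lemma integral_inner_score_sq (h : LinearIVModel P β₀ γ X Y Z ε ξ)
    (t : EuclideanSpace ℝ (Fin d)) :
    ∫ ω, (inner ℝ t (score β₀ (X 0 ω, Y 0 ω, Z 0 ω)) : ℝ) ^ 2 ∂P =
      (∫ ω, ε 0 ω ^ 2 ∂P) * (t.ofLp ⬝ᵥ crossMoment P (Z 0) (Z 0) *ᵥ t.ofLp) := by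
  set f : Ω → ℝ := fun ω => inner ℝ t (Z 0 ω) ^ 2 with hf
  set g : Ω → ℝ := fun ω => ε 0 ω ^ 2 with hg
  have hε : MemLp (ε 0) 2 P := h.memLp_four.2.2.mono_exponent (by norm_num)
  have e : (fun ω => (inner ℝ t (score β₀ (X 0 ω, Y 0 ω, Z 0 ω)) : ℝ) ^ 2) =ᵐ[P] f * g := by
    filter_upwards [h.score_ae_eq 0] with ω hω
    rw [hω]
    simp only [hf, hg, inner_smul_right, Pi.mul_apply]
    ring
  have hInt : Integrable (f * g) P := by
    refine Integrable.congr (h.memLp_score.const_inner (𝕜 := ℝ) t).integrable_sq e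
  have hle : MeasurableSpace.comap (Z 0) inferInstance ≤ ‹MeasurableSpace Ω› :=
    (h.measurable_Z 0).comap_le
  have hfm : StronglyMeasurable[MeasurableSpace.comap (Z 0) inferInstance] f := by
    refine Measurable.stronglyMeasurable ?_
    have : Measurable fun z : EuclideanSpace ℝ (Fin d) => (inner ℝ t z : ℝ) ^ 2 := by fun_prop
    exact this.comp (comap_measurable (Z 0))
  have hce := condExp_mul_of_stronglyMeasurable_left hfm hInt hε.integrable_sq
  rw [integral_congr_ae e, ← integral_condExp hle, integral_congr_ae hce,
    dotProduct_crossMoment_mulVec h.memLp_two_Z h.memLp_two_Z, ← integral_const_mul]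
  refine integral_congr_ae ?_
  filter_upwards [h.homoskedastic] with ω hω
  rw [Pi.mul_apply, hg, hω, mul_comm]
  exact congrArg (_ * ·) (sq _)

lemma tendsto_mean_Z_Z (h : LinearIVModel P β₀ γ X Y Z ε ξ) :
    ∀ᵐ ω ∂P, Tendsto (fun n : ℕ => (n : ℝ)⁻¹ •
      ((dataMatrix n (Z · ω))ᵀ * dataMatrix n (Z · ω))) atTop
      (𝓝 (crossMoment P (Z 0) (Z 0))) := by
  have key : ∀ i j, _ := fun i j => h.strong_law (φ := fun w => w.2.2 i * w.2.2 j)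
    (by fun_prop) ((memLp_ofLp_apply h.memLp_two_Z i).integrable_mul
      (memLp_ofLp_apply h.memLp_two_Z j))
  filter_upwards [ae_all_iff.2 fun i => ae_all_iff.2 fun j => key i j] with ω hω
  refine tendsto_pi_nhds.2 fun i => tendsto_pi_nhds.2 fun j => ?_
  simpa [dataMatrix, mul_apply, crossMoment] using hω i j

lemma tendsto_mean_Z_X (h : LinearIVModel P β₀ γ X Y Z ε ξ) :
    ∀ᵐ ω ∂P, Tendsto (fun n : ℕ => (n : ℝ)⁻¹ •
      ((dataMatrix n (Z · ω))ᵀ * dataMatrix n (X · ω))) atTop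
      (𝓝 (crossMoment P (Z 0) (X 0))) := by
  have key : ∀ i j, _ := fun i j => h.strong_law (φ := fun w => w.2.2 i * w.1 j)
    (by fun_prop) ((memLp_ofLp_apply h.memLp_two_Z i).integrable_mul
      (memLp_ofLp_apply h.memLp_two_X j))
  filter_upwards [ae_all_iff.2 fun i => ae_all_iff.2 fun j => key i j] with ω hω
  refine tendsto_pi_nhds.2 fun i => tendsto_pi_nhds.2 fun j => ?_
  simpa [dataMatrix, mul_apply, crossMoment] using hω i j

lemma tendsto_mean_moment_residual (h : LinearIVModel P β₀ γ X Y Z ε ξ) :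
    ∀ᵐ ω ∂P, Tendsto (fun n : ℕ =>
      (n : ℝ)⁻¹ • ((dataMatrix n (Z · ω))ᵀ *ᵥ dataVector n (Y · ω)) -
      ((n : ℝ)⁻¹ • ((dataMatrix n (Z · ω))ᵀ * dataMatrix n (X · ω))) *ᵥ β₀.ofLp) atTop
      (𝓝 0) := by
  have hm := measurable_score (β₀ := β₀) (d := d)
  have hInt := h.memLp_score.integrable (by norm_num)
  have hz : ∫ ω, score β₀ (X 0 ω, Y 0 ω, Z 0 ω) ∂P = 0 := by
    refine ext_inner_left ℝ fun t => ?_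
    rw [← integral_inner hInt, h.integral_inner_score, inner_zero_right]
  have := strong_law_ae (fun i ω => score β₀ (X i ω, Y i ω, Z i ω)) hInt
    (fun i j hij => (h.iIndepFun_comp hm).indepFun hij) (h.identDistrib_comp hm)
  filter_upwards [this] with ω hω
  rw [hz] at hω
  simp only [mean_moment_residual_eq]
  exact ((PiLp.continuous_ofLp 2 (fun _ : Fin d => ℝ)).tendsto 0).comp hω

end LinearIVModel

lemma smallestEigenvalue_fin_one (M : Matrix (Fin 1) (Fin 1) ℝ) :
    smallestEigenvalue M = M 0 0 := by
  have hM : ∀ v : Fin 1 → ℝ, toLin' M v = M 0 0 • v := fun v => by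
    ext i
    fin_cases i
    simp [mulVec, dotProduct]
  have : {l : ℝ | Module.End.HasEigenvalue (toLin' M) l} = {M 0 0} := by
    ext l
    simp only [Set.mem_ofPred_eq, Set.mem_singleton_iff]
    constructor
    · intro h
      obtain ⟨v, hv⟩ := h.exists_hasEigenvector
      have h1 := hv.apply_eq_smul
      rw [hM] at h1
      exact (smul_left_injective ℝ hv.2 h1).symm
    · rintro rfl
      refine Module.End.hasEigenvalue_of_hasEigenvector (x := fun _ => 1) ?_
      rw [Module.End.hasEigenvector_iff, Module.End.mem_eigenspace_iff]
      exact ⟨hM _, fun h => one_ne_zero (congrFun h 0)⟩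
  rw [smallestEigenvalue, this, csInf_singleton]

/-! ### Measurability of matrix operations and of TSLS. -/

instance measurableSpaceMatrix (k m : ℕ) : MeasurableSpace (Matrix (Fin k) (Fin m) ℝ) :=
  inferInstanceAs (MeasurableSpace (Fin k → Fin m → ℝ))

instance secondCountableTopologyMatrix (k m : ℕ) :
    SecondCountableTopology (Matrix (Fin k) (Fin m) ℝ) :=
  inferInstanceAs (SecondCountableTopology (Fin k → Fin m → ℝ))

instance borelSpaceMatrix (k m : ℕ) : BorelSpace (Matrix (Fin k) (Fin m) ℝ) :=
  inferInstanceAs (BorelSpace (Fin k → Fin m → ℝ))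

/-- The inverse may be discontinuous at singular matrices, but det⁻¹ • adjugate, with 0⁻¹ = 0, is
measurable everywhere. -/
lemma measurable_matrix_inv {m : ℕ} :
    Measurable fun M : Matrix (Fin m) (Fin m) ℝ => M⁻¹ := by
  have h1 : Measurable fun M : Matrix (Fin m) (Fin m) ℝ => M.det :=
    (Continuous.matrix_det continuous_id).measurable
  have h2 : Measurable fun M : Matrix (Fin m) (Fin m) ℝ => M.adjugate :=
    (Continuous.matrix_adjugate continuous_id).measurable
  have e : (fun M : Matrix (Fin m) (Fin m) ℝ => M⁻¹) = fun M => M.det⁻¹ • M.adjugate := by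
    ext1 M
    rw [inv_def, Ring.inverse_eq_inv']
  rw [e]
  exact h1.inv.smul h2

lemma measurable_matrix_mul {Ω : Type*} [MeasurableSpace Ω] {k m n : ℕ}
    {A : Ω → Matrix (Fin k) (Fin m) ℝ} {B : Ω → Matrix (Fin m) (Fin n) ℝ} (hA : Measurable A)
    (hB : Measurable B) : Measurable fun ω => A ω * B ω :=
  (Continuous.matrix_mul continuous_fst continuous_snd).measurable.comp (hA.prodMk hB)

lemma measurable_matrix_mulVec {Ω : Type*} [MeasurableSpace Ω] {k m : ℕ}
    {A : Ω → Matrix (Fin k) (Fin m) ℝ} {v : Ω → Fin m → ℝ} (hA : Measurable A)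
    (hv : Measurable v) : Measurable fun ω => A ω *ᵥ v ω :=
  (Continuous.matrix_mulVec continuous_fst continuous_snd).measurable.comp (hA.prodMk hv)

lemma measurable_matrix_transpose {Ω : Type*} [MeasurableSpace Ω] {k m : ℕ}
    {A : Ω → Matrix (Fin k) (Fin m) ℝ} (hA : Measurable A) : Measurable fun ω => (A ω)ᵀ :=
  (continuous_id.matrix_transpose).measurable.comp hA

lemma measurable_dataMatrix {Ω : Type*} [MeasurableSpace Ω] {m : ℕ}
    {U : ℕ → Ω → EuclideanSpace ℝ (Fin m)} (hU : ∀ i, Measurable (U i)) (n : ℕ) :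
    Measurable fun ω => dataMatrix n (U · ω) := by
  refine measurable_pi_lambda _ fun i => measurable_pi_lambda _ fun j => ?_
  have := hU i
  simp only [dataMatrix, of_apply]
  fun_prop

namespace LinearIVModel

variable {p d : ℕ} {β₀ : EuclideanSpace ℝ (Fin p)} {Ω : Type*} [MeasurableSpace Ω]
  {P : Measure Ω} {γ : Matrix (Fin d) (Fin p) ℝ} {X : ℕ → Ω → EuclideanSpace ℝ (Fin p)}
  {Y : ℕ → Ω → ℝ} {Z : ℕ → Ω → EuclideanSpace ℝ (Fin d)} {ε : ℕ → Ω → ℝ}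
  {ξ : ℕ → Ω → EuclideanSpace ℝ (Fin p)}

lemma measurable_tsls (h : LinearIVModel P β₀ γ X Y Z ε ξ) (n : ℕ) :
    Measurable fun ω =>
      tsls (dataMatrix n (X · ω)) (dataVector n (Y · ω)) (dataMatrix n (Z · ω)) := by
  have hX := measurable_dataMatrix h.measurable_X n
  have hZ := measurable_dataMatrix h.measurable_Z n
  have hY : Measurable fun ω => dataVector n (Y · ω) :=
    measurable_pi_lambda _ fun i => h.measurable_Y i
  have hXt := measurable_matrix_transpose hX
  have hZt := measurable_matrix_transpose hZ
  have hproj : Measurable fun ω => projMatrix (dataMatrix n (Z · ω)) :=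
    measurable_matrix_mul (measurable_matrix_mul hZ
      (measurable_matrix_inv.comp (measurable_matrix_mul hZt hZ))) hZt
  exact (WithLp.measurable_toLp 2 _).comp (measurable_matrix_mulVec
    (measurable_matrix_inv.comp (measurable_matrix_mul (measurable_matrix_mul hXt hproj) hX))
    (measurable_matrix_mulVec hXt (measurable_matrix_mulVec hproj hY)))

/-! ### Normalized scores and comparison of the estimators. -/

variable [IsProbabilityMeasure P]

/-- Asymptotic normality of linear images of the normalized scores. -/
lemma tendstoInDistribution_mulVec_score (h : LinearIVModel P β₀ γ X Y Z ε ξ) {m : ℕ}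
    (K : Matrix (Fin m) (Fin d) ℝ) :
    TendstoInDistribution (fun (n : ℕ) ω => (√(n : ℝ))⁻¹ • ∑ i ∈ Finset.range n,
        WithLp.toLp 2 (K *ᵥ (score β₀ (X i ω, Y i ω, Z i ω)).ofLp)) atTop
      id (fun _ => P) (multivariateGaussian 0
        ((∫ ω, ε 0 ω ^ 2 ∂P) • (K * crossMoment P (Z 0) (Z 0) * Kᵀ))) := by
  set φ : EuclideanSpace ℝ (Fin p) × ℝ × EuclideanSpace ℝ (Fin d) → EuclideanSpace ℝ (Fin m) :=
    fun w => WithLp.toLp 2 (K *ᵥ (score β₀ w).ofLp) with hφ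
  have hL : Continuous fun v : EuclideanSpace ℝ (Fin d) =>
      (WithLp.toLp 2 (K *ᵥ v.ofLp) : EuclideanSpace ℝ (Fin m)) := by fun_prop
  have hm : Measurable φ := hL.measurable.comp measurable_score
  have hin : ∀ (t : EuclideanSpace ℝ (Fin m)) w,
      (inner ℝ t (φ w) : ℝ) = inner ℝ (WithLp.toLp 2 (Kᵀ *ᵥ t.ofLp)) (score β₀ w) :=
    fun t w => by
      simp only [hφ, EuclideanSpace.inner_eq_star_dotProduct, star_trivial]
      rw [dotProduct_comm, dotProduct_mulVec, ← mulVec_transpose, dotProduct_comm]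
  refine tendstoInDistribution_inv_sqrt_smul_sum (W := fun i ω => φ (X i ω, Y i ω, Z i ω))
    (h.iIndepFun_comp hm) (h.identDistrib_comp hm) ?_ (fun t => ?_) ?_ fun t => ?_
  · exact h.memLp_score.continuousLinearMap_comp (toLpLin 2 2 K).toContinuousLinearMap
  · simp only [hin]
    exact h.integral_inner_score _
  · have := (h.posDef_crossMoment.posSemidef.mul_mul_conjTranspose_same K).smul
      (integral_nonneg fun ω => sq_nonneg (ε 0 ω) : (0 : ℝ) ≤ ∫ ω, ε 0 ω ^ 2 ∂P)
    rwa [conjTranspose_eq_transpose_of_trivial] at this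
  · simp only [hin]
    rw [h.integral_inner_score_sq]
    simp only [smul_mulVec, dotProduct_smul, smul_eq_mul]
    rw [← mulVec_mulVec, ← mulVec_mulVec, dotProduct_mulVec t.ofLp, ← mulVec_transpose]

/-- Serves as the yardstick for negligibility: what matters is that a limit law exists, so its
covariance is left unsimplified. -/
lemma tendstoInDistribution_score (h : LinearIVModel P β₀ γ X Y Z ε ξ) :
    TendstoInDistribution (fun (n : ℕ) ω => (√(n : ℝ))⁻¹ • ∑ i ∈ Finset.range n,
        score β₀ (X i ω, Y i ω, Z i ω)) atTop
      id (fun _ => P) (multivariateGaussian 0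
        ((∫ ω, ε 0 ω ^ 2 ∂P) • ((1 : Matrix (Fin d) (Fin d) ℝ) * crossMoment P (Z 0) (Z 0) *
          (1 : Matrix (Fin d) (Fin d) ℝ)ᵀ))) := by
  simpa only [one_mulVec, WithLp.toLp_ofLp] using
    h.tendstoInDistribution_mulVec_score (1 : Matrix (Fin d) (Fin d) ℝ)

lemma sqrt_smul_inv_smul {V : Type*} [AddCommGroup V] [Module ℝ V] (n : ℕ) (v : V) :
    √(n : ℝ) • ((n : ℝ)⁻¹ • v) = (√(n : ℝ))⁻¹ • v := by
  rw [smul_smul]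
  congr 1
  rw [← div_eq_mul_inv, Real.sqrt_div_self', one_div]

/-- Asymptotic linearity of the two stage least squares estimator. -/
lemma exists_tsls_linearization (h : LinearIVModel P β₀ γ X Y Z ε ξ) :
    ∀ᵐ ω ∂P, ∃ a : ℕ → ℝ, Tendsto a atTop (𝓝 0) ∧ ∀ᶠ n : ℕ in atTop,
      ‖√(n : ℝ) • (tsls (dataMatrix n (X · ω)) (dataVector n (Y · ω)) (dataMatrix n (Z · ω)) - β₀) -
        (√(n : ℝ))⁻¹ • ∑ i ∈ Finset.range n, WithLp.toLp 2
          (gmmMatrix (crossMoment P (Z 0) (Z 0)) (crossMoment P (Z 0) (X 0)) *ᵥ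
            (score β₀ (X i ω, Y i ω, Z i ω)).ofLp)‖ ≤
        a n * ‖(√(n : ℝ))⁻¹ • ∑ i ∈ Finset.range n, score β₀ (X i ω, Y i ω, Z i ω)‖ := by
  have hT := h.posDef_crossMoment.det_pos.ne'
  have hA := h.posDef_first_stage.det_pos.ne'
  rw [← h.gmm_hessian_eq] at hA
  filter_upwards [h.tendsto_mean_Z_Z, h.tendsto_mean_Z_X] with ω hS hC
  obtain ⟨a, ha, hle⟩ := exists_gmm_linearization
    (c := fun n => (n : ℝ)⁻¹ • ((dataMatrix n (Z · ω))ᵀ *ᵥ dataVector n (Y · ω)))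
    hS hT hC hA β₀.ofLp
  refine ⟨a, ha, ?_⟩
  filter_upwards [hle, eventually_gt_atTop 0, eventually_isUnit_det hS hT,
    eventually_isUnit_det (tendsto_gmm_hessian hS hT hC) hA] with n h1 hn h2 h3
  have hn' : (n : ℝ) ≠ 0 := by exact_mod_cast hn.ne'
  have hZ : IsUnit ((dataMatrix n (Z · ω))ᵀ * dataMatrix n (Z · ω)).det := by
    rw [det_smul] at h2
    exact isUnit_of_mul_isUnit_right h2
  rw [mean_moment_residual_eq] at h1
  have h4 := mul_le_mul_of_nonneg_left h1 (Real.sqrt_nonneg (n : ℝ))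
  have hs : ‖√(n : ℝ)‖ = √(n : ℝ) := Real.norm_of_nonneg (Real.sqrt_nonneg _)
  rw [mul_left_comm, ← hs, ← norm_smul, ← norm_smul] at h4
  have e1 : √(n : ℝ) • (WithLp.toLp 2 ((n : ℝ)⁻¹ •
      (∑ i ∈ Finset.range n, score β₀ (X i ω, Y i ω, Z i ω)).ofLp) : EuclideanSpace ℝ (Fin d)) =
      (√(n : ℝ))⁻¹ • ∑ i ∈ Finset.range n, score β₀ (X i ω, Y i ω, Z i ω) := by
    rw [WithLp.toLp_smul, WithLp.toLp_ofLp, sqrt_smul_inv_smul]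
  rw [e1] at h4
  convert! h4 using 2
  rw [WithLp.toLp_sub, WithLp.toLp_sub, WithLp.toLp_ofLp, smul_sub √(n : ℝ) (_ - _),
    ← tsls_eq_gmmMatrix_mulVec hn hZ h3, WithLp.toLp_ofLp, mulVec_smul, WithLp.toLp_smul,
    sqrt_smul_inv_smul, WithLp.ofLp_sum, mulVec_sum, WithLp.toLp_sum]

/-- The DRIVE and the two stage least squares estimators differ by a quantity negligible relative
to the normalized score. -/
lemma exists_drive_sub_tsls_le (h : LinearIVModel P β₀ γ X Y Z ε ξ)
    {ρ : ℕ → ℝ} {ρlim : ℝ} (hρ_nonneg : ∀ n, 0 ≤ ρ n) (hρ : Tendsto ρ atTop (𝓝 ρlim))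
    {βDRIVE : ℕ → Ω → EuclideanSpace ℝ (Fin p)}
    (hβ : ∀ n, ∀ᵐ ω ∂P,
      IsUnit ((dataMatrix n (Z · ω))ᵀ * dataMatrix n (Z · ω)).det →
        IsDRIVE (ρ n) (dataMatrix n (X · ω)) (dataVector n (Y · ω)) (dataMatrix n (Z · ω))
          (βDRIVE n ω))
    (hcase : (ρlim = 0 ∨ β₀ = 0) ∨
      (ρlim ≤ smallestEigenvalue (γᵀ * crossMoment P (Z 0) (Z 0) * γ) ∧ d = 1 ∧ p = 1)) :
    ∀ᵐ ω ∂P, ∃ a : ℕ → ℝ, Tendsto a atTop (𝓝 0) ∧ ∀ᶠ n : ℕ in atTop,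
      ‖√(n : ℝ) • (βDRIVE n ω - β₀) - √(n : ℝ) •
        (tsls (dataMatrix n (X · ω)) (dataVector n (Y · ω)) (dataMatrix n (Z · ω)) - β₀)‖ ≤
        a n * ‖(√(n : ℝ))⁻¹ • ∑ i ∈ Finset.range n, score β₀ (X i ω, Y i ω, Z i ω)‖ := by
  have hT := h.posDef_crossMoment.det_pos.ne'
  have hA := h.posDef_first_stage
  have hHess := h.gmm_hessian_eq
  rw [← hHess] at hA
  have hAdet := hA.det_pos.ne'
  filter_upwards [h.tendsto_mean_Z_Z, h.tendsto_mean_Z_X, h.tendsto_mean_moment_residual,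
    ae_all_iff.2 hβ] with ω hS hC hg hD
  set c : ℕ → Fin d → ℝ :=
    fun n => (n : ℝ)⁻¹ • ((dataMatrix n (Z · ω))ᵀ *ᵥ dataVector n (Y · ω)) with hc
  have hunit : ∀ᶠ n in atTop, 0 < n ∧
      IsUnit ((dataMatrix n (Z · ω))ᵀ * dataMatrix n (Z · ω)).det := by
    filter_upwards [eventually_isUnit_det hS hT, eventually_gt_atTop 0] with n h2 hn
    rw [det_smul] at h2
    exact ⟨hn, isUnit_of_mul_isUnit_right h2⟩
  have hsymm : ∀ n : ℕ, ((n : ℝ)⁻¹ • ((dataMatrix n (Z · ω))ᵀ * dataMatrix n (Z · ω)))ᵀ =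
      (n : ℝ)⁻¹ • ((dataMatrix n (Z · ω))ᵀ * dataMatrix n (Z · ω)) := fun n => by
    simp [transpose_smul, transpose_mul]
  have hnonneg := hunit.mono fun n hn => gmmCriterion_nonneg
    (X := dataMatrix n (X · ω)) (Y := dataVector n (Y · ω)) hn.1 hn.2
  have hmin := hunit.mono fun n hn => (hD n hn.2).sqrt_add_le (hρ_nonneg n) hn.1 hn.2
  have htsls : ∀ᶠ n : ℕ in atTop,
      tsls (dataMatrix n (X · ω)) (dataVector n (Y · ω)) (dataMatrix n (Z · ω)) =
        WithLp.toLp 2 (gmmMatrix ((n : ℝ)⁻¹ • ((dataMatrix n (Z · ω))ᵀ * dataMatrix n (Z · ω)))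
          ((n : ℝ)⁻¹ • ((dataMatrix n (Z · ω))ᵀ * dataMatrix n (X · ω))) *ᵥ c n) := by
    filter_upwards [hunit, eventually_isUnit_det (tendsto_gmm_hessian hS hT hC) hAdet]
      with n hn h3
    rw [hc, ← tsls_eq_gmmMatrix_mulVec hn.1 hn.2 h3, WithLp.toLp_ofLp]
  rcases hcase with hcase | ⟨hle, hd, hp⟩
  · obtain ⟨a, ha, hbound⟩ := exists_regularized_sub_le hS hT hsymm hC hA hnonneg hg hρ hcase hmin
    refine ⟨a, ha, ?_⟩
    filter_upwards [hbound, htsls] with n h1 h2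
    rw [← h2, mean_moment_residual_eq, WithLp.toLp_smul, WithLp.toLp_ofLp] at h1
    have h4 := mul_le_mul_of_nonneg_left h1 (Real.sqrt_nonneg (n : ℝ))
    have hs : ‖√(n : ℝ)‖ = √(n : ℝ) := Real.norm_of_nonneg (Real.sqrt_nonneg _)
    rw [mul_left_comm, ← hs, ← norm_smul, ← norm_smul, sqrt_smul_inv_smul] at h4
    rwa [← smul_sub, sub_sub_sub_cancel_right]
  · subst hd hp
    rw [smallestEigenvalue_fin_one, ← hHess] at hle
    have hpos : 0 < ((crossMoment P (Z 0) (X 0))ᵀ * (crossMoment P (Z 0) (Z 0))⁻¹ *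
        crossMoment P (Z 0) (X 0)) 0 0 := hA.diag_pos
    have heq := eventually_regularized_eq hS hT hsymm hC hAdet hnonneg hg hρ hpos
      (ge_of_tendsto' hρ hρ_nonneg) hle
      (fun u => le_of_eq (by
        simp only [EuclideanSpace.real_norm_sq_eq, dotProduct, mulVec,
          Finset.univ_unique, Fin.default_eq_zero, Finset.sum_singleton]
        ring)) hmin
    -- The estimators eventually coincide, so the zero rate is admissible.
    refine ⟨0, tendsto_const_nhds, ?_⟩
    filter_upwards [heq, htsls] with n h1 h2
    rw [h2, h1]
    simp [hc]

end LinearIVModel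

end WassersteinDRIVE

/-! ### The limit theorem. -/

open WassersteinDRIVE in
theorem corollary1 {Ω : Type*} [MeasurableSpace Ω] (P : Measure Ω) [IsProbabilityMeasure P]
    {p d : ℕ} (β₀ : EuclideanSpace ℝ (Fin p)) (γ : Matrix (Fin d) (Fin p) ℝ)
    (X : ℕ → Ω → EuclideanSpace ℝ (Fin p)) (Y : ℕ → Ω → ℝ)
    (Z : ℕ → Ω → EuclideanSpace ℝ (Fin d))
    (ε : ℕ → Ω → ℝ) (ξ : ℕ → Ω → EuclideanSpace ℝ (Fin p))
    (hmodel : LinearIVModel P β₀ γ X Y Z ε ξ)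
    (Sig : Matrix (Fin d) (Fin d) ℝ) (hSig : Sig = crossMoment P (Z 0) (Z 0))
    (ρ : ℕ → ℝ) (ρlim : ℝ) (hρ_nonneg : ∀ n, 0 ≤ ρ n) (hρ : Tendsto ρ atTop (𝓝 ρlim))
    (βDRIVE : ℕ → Ω → EuclideanSpace ℝ (Fin p))
    (hβ_meas : ∀ n, AEMeasurable (βDRIVE n) P)
    (hβ : ∀ n, ∀ᵐ ω ∂P,
      IsUnit ((dataMatrix n (Z · ω))ᵀ * dataMatrix n (Z · ω)).det →
        IsDRIVE (ρ n) (dataMatrix n (X · ω)) (dataVector n (Y · ω)) (dataMatrix n (Z · ω))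
          (βDRIVE n ω))
    (hcase : ρlim = 0 ∨
      (ρlim ≤ smallestEigenvalue (γᵀ * Sig * γ) ∧ β₀ = 0) ∨
      (ρlim ≤ smallestEigenvalue (γᵀ * Sig * γ) ∧ d = 1 ∧ p = 1)) :
    let V : Matrix (Fin p) (Fin p) ℝ := (∫ ω, ε 0 ω ^ 2 ∂P) • (γᵀ * Sig * γ)⁻¹
    TendstoInDistribution (fun (n : ℕ) ω => √(n : ℝ) • (βDRIVE n ω - β₀)) atTop
        id (fun _ => P) (multivariateGaussian 0 V) ∧
      TendstoInDistribution
        (fun (n : ℕ) ω => √(n : ℝ) •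
          (tsls (dataMatrix n (X · ω)) (dataVector n (Y · ω)) (dataMatrix n (Z · ω)) - β₀)) atTop
        id (fun _ => P) (multivariateGaussian 0 V) := by
  intro V
  subst hSig
  have hcase' : (ρlim = 0 ∨ β₀ = 0) ∨
      (ρlim ≤ smallestEigenvalue (γᵀ * crossMoment P (Z 0) (Z 0) * γ) ∧ d = 1 ∧ p = 1) := by
    tauto
  set A := γᵀ * crossMoment P (Z 0) (Z 0) * γ with hA
  have hAdet : IsUnit A.det := hmodel.posDef_first_stage.det_pos.ne'.isUnit
  have hAt : Aᵀ = A := by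
    simp [hA, transpose_crossMoment_self, Matrix.mul_assoc]
  have hscore := hmodel.tendstoInDistribution_score
  have hlin := hmodel.tendstoInDistribution_mulVec_score (A⁻¹ * γᵀ)
  -- The sandwich covariance collapses: A⁻¹ γᵀ Σ_Z γ A⁻¹ = A⁻¹.
  have hV : (∫ ω, ε 0 ω ^ 2 ∂P) •
      (A⁻¹ * γᵀ * crossMoment P (Z 0) (Z 0) * (A⁻¹ * γᵀ)ᵀ) = V := by
    have : A⁻¹ * γᵀ * crossMoment P (Z 0) (Z 0) * (A⁻¹ * γᵀ)ᵀ = A⁻¹ * (A * A⁻¹) := by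
      rw [transpose_mul, transpose_transpose, transpose_nonsing_inv, hAt]
      simp only [hA, Matrix.mul_assoc]
    rw [this, mul_nonsing_inv _ hAdet, Matrix.mul_one]
  rw [hV] at hlin
  have htsls_meas : ∀ n : ℕ, AEMeasurable (fun ω => √(n : ℝ) •
      (tsls (dataMatrix n (X · ω)) (dataVector n (Y · ω)) (dataMatrix n (Z · ω)) - β₀)) P :=
    fun n => (((hmodel.measurable_tsls n).sub_const β₀).const_smul √(n : ℝ)).aemeasurable
  -- Slutsky is used twice: from the linearized scores to TSLS here, and from TSLS to DRIVE at the
  -- end.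
  have htsls := tendstoInDistribution_of_tendstoInMeasure_sub _ id hlin
    (tendstoInMeasure_zero_of_le_mul_norm hscore
      (fun n => ((htsls_meas n).sub (hlin.forall_aemeasurable n)).aestronglyMeasurable) (by
        have := hmodel.exists_tsls_linearization
        rw [hmodel.gmmMatrix_eq] at this
        exact this)) htsls_meas
  have hdrive_meas : ∀ n : ℕ, AEMeasurable (fun ω => √(n : ℝ) • (βDRIVE n ω - β₀)) P :=
    fun n => ((hβ_meas n).sub_const β₀).const_smul √(n : ℝ)
  exact ⟨tendstoInDistribution_of_tendstoInMeasure_sub _ id htsls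
    (tendstoInMeasure_zero_of_le_mul_norm hscore
      (fun n => ((hdrive_meas n).sub (htsls_meas n)).aestronglyMeasurable)
      (hmodel.exists_drive_sub_tsls_le hρ_nonneg hρ hβ hcase')) hdrive_meas, htsls⟩
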